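/- Let $\mathcal G$ be a countable directed graph with vertex set $\mathcal G_V$, arrow set $\mathcal G_{Ar}$ and source and range maps $s,r:\mathcal G_{Ar}\to\mathcal G_V$, and let $V_\infty$ be the set of vertices $v$ for which $s^{-1}(v)$ is empty or infinite. Let $C^*(\mathcal G)$ be the universal $C^*$-algebra generated by partial isometries $S_a$, $a\in\mathcal G_{Ar}$, and mutually orthogonal projections $P_v$, $v\in\mathcal G_V$, subject to $S_a^*S_a=P_{r(a)}$, $S_aS_a^*\le P_{s(a)}$, $\sum_{a\in E}S_aS_a^*\le P_v$ for every finite $E\subseteq s^{-1}(v)$, and $P_v=\sum_{a\in s^{-1}(v)}S_aS_a^*$ for $v\notin V_\infty$. Finite paths $\mu=a_1\cdots a_n$ satisfy $r(a_i)=s(a_{i+1})$, with $s(\mu)=s(a_1)$ and $r(\mu)=r(a_n)$; vertices count as paths of length $0$. Let $P(\mathcal G)\subseteq(\mathcal G_{Ar})^{\mathbb N}$ be the space of infinite paths with the product topology ($\mathcal G_{Ar}$ discrete), and let $Z(\mu)\subseteq P(\mathcal G)$ be the set of infinite paths that begin with $\mu$ (that start at $v$, when $\mu=v$ is a vertex).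 Let $F:\mathcal G_{Ar}\to\mathbb R$ be a function, $\beta\in\mathbb R$, and put $F(a_1\cdots a_n)=\sum_iF(a_i)$ and $F(v)=0$ for vertices $v$. Let $A(\beta)_{v,w}=\sum_{s(a)=v,\,r(a)=w}e^{-\beta F(a)}\in[0,\infty]$. A non-zero vector $\varphi\in[0,\infty)^{\mathcal G_V}$ is almost $A(\beta)$-harmonic when $\sum_wA(\beta)_{v,w}\varphi_w\le\varphi_v$ for all $v$, with equality for $v\notin V_\infty$; it is $A(\beta)$-harmonic when equality holds for all $v$. An almost $A(\beta)$-harmonic vector $\varphi$ is minimal when every almost $A(\beta)$-harmonic vector $\varphi'$ with $\varphi'_v\le\varphi_v$ for all $v$ is of the form $\lambda\varphi$ with $\lambda>0$. An $A(\beta)$-harmonic vector $\varphi$ determines a Borel measure $m_\varphi$ on $P(\mathcal G)$ with $m_\varphi(Z(\mu))=e^{-\beta F(\mu)}\varphi_{r(\mu)}$ for all finite paths $\mu$. Let $NW_{\mathcal G}$ be the set of vertices $v$ for which there is a finite path $\mu$ of positive length with $s(\mu)=r(\mu)=v$. Let $P(\mathcal G)_{rec}$ be the set of infinite paths that contain every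 arrow $a$ with $s(a)\in NW_{\mathcal G}$ infinitely often when $NW_{\mathcal G}\ne\emptyset$, and $P(\mathcal G)_{rec}=\emptyset$ when $NW_{\mathcal G}=\emptyset$. The $A(\beta)$-harmonic vector $\varphi$ is conservative when $m_\varphi(P(\mathcal G)\setminus P(\mathcal G)_{rec})=0$. Theorem. Assume that $C^*(\mathcal G)$ is simple. There is a conservative $A(\beta)$-harmonic vector if and only if (1) $NW_{\mathcal G}\neq\emptyset$, (2) $\sum_{n=0}^\infty A(\beta)^n_{v,v}=\infty$, and (3) $\limsup_n\left(A(\beta)^n_{v,v}\right)^{1/n}=1$ for one $v\in NW_{\mathcal G}$, equivalently for all $v\in NW_{\mathcal G}$; each of the conditions (2) and (3) holds for all $v\in NW_{\mathcal G}$ as soon as it holds for one. When a conservative $A(\beta)$-harmonic vector exists, it is unique up to multiplication by positive scalars and it is minimal. -/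

import Mathlib

open scoped ENNReal NNReal

/-- A directed graph with vertex set `V` and arrow set `Ar`; multiple arrows between two vertices
and arrows from a vertex to itself are allowed. -/
structure DiGraph (V : Type*) (Ar : Type*) where
  /-- the source of an arrow -/
  src : Ar → V
  /-- the range of an arrow -/
  rng : Ar → V

namespace DiGraph

/-! ### The graph C*-algebra -/

section CStar

universe u w

variable {V : Type u} {Ar : Type w} (G : DiGraph V Ar)

/-- The set `s⁻¹(v)` of arrows emitted by `v`. -/
def out (v : V) : Set Ar := {a | G.src a = v}

/-- The set `V_∞` of sinks and infinite emitters. -/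
def singularVertices : Set V := {v | G.out v = ∅ ∨ (G.out v).Infinite}

theorem finite_out {v : V} (hv : v ∉ G.singularVertices) : (G.out v).Finite := by
  by_contra h
  exact hv (Or.inr h)

/-- The order `x ≤ y` of a C*-algebra: `y - x` is of the form `z* z`. -/
def CStarLE {B : Type*} [NonUnitalCStarAlgebra B] (x y : B) : Prop :=
  ∃ z : B, y - x = star z * z

/-- The relations which define the C*-algebra of the graph `G`. (The elements `S a` are partial
isometries by the relation `star_mul_self`.) -/
structure IsCuntzKrieger {B : Type*} [NonUnitalCStarAlgebra B] (S : Ar → B) (P : V → B) :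
    Prop where
  proj : ∀ v, IsStarProjection (P v)
  orth : ∀ v v', v ≠ v' → P v * P v' = 0
  star_mul_self : ∀ a, star (S a) * S a = P (G.rng a)
  mul_star_le : ∀ a, CStarLE (S a * star (S a)) (P (G.src a))
  sum_le : ∀ (v : V) (E : Finset Ar), (E : Set Ar) ⊆ G.out v →
    CStarLE (∑ a ∈ E, S a * star (S a)) (P v)
  sum_eq : ∀ (v : V) (hv : v ∉ G.singularVertices),
    P v = ∑ a ∈ (G.finite_out hv).toFinset, S a * star (S a)

/-- A representation of the defining relations in some C*-algebra. -/
structure CKRep where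
  /-- the C*-algebra -/
  alg : Type
  [cstar : NonUnitalCStarAlgebra alg]
  /-- the partial isometries -/
  S : Ar → alg
  /-- the projections -/
  P : V → alg
  rel : G.IsCuntzKrieger S P

instance (R : G.CKRep) : NonUnitalCStarAlgebra R.alg := R.cstar

theorem CKRep.norm_P_le (R : G.CKRep) (v : V) : ‖R.P v‖ ≤ 1 :=
  (R.rel.proj v).norm_le

theorem CKRep.norm_S_le (R : G.CKRep) (a : Ar) : ‖R.S a‖ ≤ 1 := by
  have h : ‖R.S a‖ * ‖R.S a‖ ≤ 1 := by
    rw [← CStarRing.norm_star_mul_self, R.rel.star_mul_self]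
    exact R.norm_P_le G _
  nlinarith [norm_nonneg (R.S a)]

/-- The C*-algebra of bounded families indexed by all representations of the relations. -/
abbrev Ambient : Type _ := lp (fun R : G.CKRep => R.alg) ∞

/-- The family of all the projections `P_v`. -/
noncomputable def univP (v : V) : G.Ambient :=
  ⟨fun R => R.P v, memℓp_infty ⟨1, by rintro _ ⟨R, rfl⟩; exact R.norm_P_le G v⟩⟩

/-- The family of all the partial isometries `S_a`. -/
noncomputable def univS (a : Ar) : G.Ambient :=
  ⟨fun R => R.S a, memℓp_infty ⟨1, by rintro _ ⟨R, rfl⟩; exact R.norm_S_le G a⟩⟩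

/-- The C*-algebra `C*(G)` of the graph: the universal C*-algebra generated by partial isometries
`S_a` and projections `P_v` subject to the relations `IsCuntzKrieger`. It is the closed
*-algebra generated by the direct sum of all representations of the relations, so that its norm
is the supremum of the norms over all representations. When `G` is countable it is no restriction
that the representing C*-algebras lie in `Type`: a C*-algebra generated by countably many elements
has at most the cardinality of the continuum. -/
noncomputable def cstarSubalgebra : NonUnitalStarSubalgebra ℂ G.Ambient :=
  (NonUnitalStarAlgebra.adjoin ℂ
    (Set.range G.univS ∪ Set.range G.univP)).topologicalClosure

instance : IsClosed (G.cstarSubalgebra : Set G.Ambient) :=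
  NonUnitalStarSubalgebra.isClosed_topologicalClosure _

/-- The graph C*-algebra `C*(G)`. -/
abbrev GraphCStar : Type _ := G.cstarSubalgebra

noncomputable instance : NonUnitalCStarAlgebra G.GraphCStar :=
  NonUnitalStarSubalgebra.nonUnitalCStarAlgebra G.cstarSubalgebra

end CStar

/-- A C*-algebra is simple when it has no closed two-sided ideals other than `0` and itself. -/
def IsSimpleCStar (A : Type*) [NonUnitalCStarAlgebra A] : Prop :=
  ∀ I : TwoSidedIdeal A, IsClosed {x : A | x ∈ I} → I = ⊥ ∨ I = ⊤

/-! ### Paths -/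

section Paths

variable {V Ar : Type*} (G : DiGraph V Ar)

/-- `IsPath v l w`: the arrows in the list `l` form a path from `v` to `w`; the empty list
is the path of length `0` at a vertex. -/
def IsPath : V → List Ar → V → Prop
  | v, [], w => v = w
  | v, a :: l, w => G.src a = v ∧ IsPath (G.rng a) l w

/-- The set `P_f(G)` of finite paths, with the vertices as the paths of length `0`. -/
structure FinPath where
  /-- the source of the path -/
  source : V
  /-- the arrows of the path -/
  arrows : List Ar
  /-- the range of the path -/
  range : V
  isPath : G.IsPath source arrows range

/-- The set `P(G)` of infinite paths; the arrows of a path are numbered from `0`. -/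
def InfPath : Type _ := {p : ℕ → Ar // ∀ i, G.rng (p i) = G.src (p (i + 1))}

/-- The topology of `P(G)`: the product topology, with the discrete topology on the arrows. -/
instance : TopologicalSpace G.InfPath :=
  TopologicalSpace.induced (fun p : G.InfPath => p.1)
    (@Pi.topologicalSpace ℕ (fun _ => Ar) (fun _ => ⊥))

/-- The Borel sets of `P(G)`. -/
instance : MeasurableSpace G.InfPath := borel G.InfPath

instance : BorelSpace G.InfPath := ⟨rfl⟩

/-- The cylinder set `Z(μ)`. -/
def cylinder (μ : G.FinPath) : Set G.InfPath :=
  {p | G.src (p.1 0) = μ.source ∧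
    ∀ (i : ℕ) (hi : i < μ.arrows.length), p.1 i = μ.arrows[i]}

/-- The set `NW_G` of non-wandering vertices: those on a loop of positive length. -/
def nonWandering : Set V :=
  {v | ∃ μ : G.FinPath, 0 < μ.arrows.length ∧ μ.source = v ∧ μ.range = v}

/-- The set `P(G)_rec` of infinite paths which pass infinitely often through every arrow that
starts in `NW_G`. It is empty when `NW_G` is empty. -/
def recurrentPaths : Set G.InfPath :=
  {p | G.nonWandering.Nonempty ∧
    ∀ a, G.src a ∈ G.nonWandering → {i : ℕ | p.1 i = a}.Infinite}

end Paths

/-! ### Harmonic vectors -/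

section Harmonic

variable {V Ar : Type*} (G : DiGraph V Ar) (F : Ar → ℝ) (β : ℝ)

/-- The matrix `A(β)`, with entries in `[0, ∞]`. -/
noncomputable def matA (v w : V) : ℝ≥0∞ :=
  ∑' a : {a : Ar // G.src a = v ∧ G.rng a = w}, ENNReal.ofReal (Real.exp (-β * F a))

open Classical in
/-- The entries `A(β)^n_{v,w}` of the powers of `A(β)`. -/
noncomputable def powA : ℕ → V → V → ℝ≥0∞
  | 0, v, w => if v = w then 1 else 0
  | n + 1, v, w => ∑' x : V, matA G F β v x * powA n x w

/-- Almost `A(β)`-harmonic vectors. -/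
structure IsAlmostHarmonic (φ : V → ℝ≥0) : Prop where
  ne_zero : φ ≠ 0
  le : ∀ v, ∑' w : V, G.matA F β v w * (φ w : ℝ≥0∞) ≤ (φ v : ℝ≥0∞)
  eq : ∀ v, v ∉ G.singularVertices → ∑' w : V, G.matA F β v w * (φ w : ℝ≥0∞) = (φ v : ℝ≥0∞)

/-- `A(β)`-harmonic vectors. -/
structure IsHarmonic (φ : V → ℝ≥0) : Prop where
  ne_zero : φ ≠ 0
  eq : ∀ v, ∑' w : V, G.matA F β v w * (φ w : ℝ≥0∞) = (φ v : ℝ≥0∞)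

/-- An almost `A(β)`-harmonic vector is minimal when it only dominates multiples of itself. -/
structure IsMinimal (φ : V → ℝ≥0) : Prop where
  almostHarmonic : G.IsAlmostHarmonic F β φ
  eq_smul : ∀ φ' : V → ℝ≥0, G.IsAlmostHarmonic F β φ' → (∀ v, φ' v ≤ φ v) →
    ∃ c : ℝ≥0, 0 < c ∧ φ' = c • φ

/-- `m` is the Borel measure `m_φ` on `P(G)`, i.e. `m(Z(μ)) = e^{-β F(μ)} φ_{r(μ)}` for every
finite path `μ`. These values determine `m`. -/
def IsPathMeasure (φ : V → ℝ≥0) (m : MeasureTheory.Measure G.InfPath) : Prop :=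
  ∀ μ : G.FinPath, m (G.cylinder μ) =
    ENNReal.ofReal (Real.exp (-β * (μ.arrows.map F).sum)) * (φ μ.range : ℝ≥0∞)

/-- An `A(β)`-harmonic vector `φ` is conservative when `m_φ` is concentrated on `P(G)_rec`. -/
structure IsConservative (φ : V → ℝ≥0) : Prop where
  harmonic : G.IsHarmonic F β φ
  concentrated : ∃ m : MeasureTheory.Measure G.InfPath,
    G.IsPathMeasure F β φ m ∧ m (G.recurrentPaths)ᶜ = 0

/-- The condition `∑_n A(β)^n_{v,v} = ∞`. -/
def SumDiverges (v : V) : Prop := ∑' n : ℕ, G.powA F β n v v = ∞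

/-- The condition `limsup_n (A(β)^n_{v,v})^{1/n} = 1`. -/
def LimsupEqOne (v : V) : Prop :=
  Filter.limsup (fun n : ℕ => G.powA F β n v v ^ (1 / (n : ℝ))) Filter.atTop = 1

end Harmonic

end DiGraph

/-! ### Partial permutation operators on `ℓ²` -/

section PartialPermutation

open scoped InnerProductSpace

variable {ι : Type*}

/-! Simplicity of the C*-algebra enters only through `eq_univ_of_isHereditary_of_isSaturated`: a
non-empty hereditary saturated set `H` of vertices is everything. For hereditary saturated `H` there
is a representation on `ℓ²` by partial permutations whose vertex projections vanish exactly on `H`,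
and the kernel of the induced map is a closed ideal. It follows that every vertex reaches every
non-wandering vertex, that the non-wandering set is hereditary, and that its saturation is the whole
graph. Non-wandering vertices therefore communicate, so the two recurrence conditions do not depend
on the vertex, and statements extend from them to all vertices by induction along regular vertices.

The rest is the theory of recurrent non-negative matrices. If the Green sum at `v` is infinite, a
superharmonic vector finite at `v` has no defect at vertices reachable from `v`
(`SumDiverges.transfer_eq`). Applied to minima of superharmonic vectors, this gives uniqueness among
all almost harmonic vectors, hence also minimality. For existence, the renewal equation and Abel
summation show that first returns to `v` have total weight 1, which makes the first passage vector
harmonic.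

The path measure of a positive harmonic vector comes from the Markov chain of its Doob transform. If
it is concentrated on recurrent paths, Borel–Cantelli forces the Green sum to diverge. Conversely,
in the recurrent case the mass of paths that ever use a given arrow `a` with non-wandering source is
superharmonic, and the absence of defect at the source of `a` makes it equal to the harmonic vector.
Almost every path then uses `a` after any finite initial piece, hence infinitely often. -/

theorem PEquiv.eq_of_get_eq (f : ι ≃. ι) {i j : ι} (hi : (f i).isSome) (hj : (f j).isSome)
    (h : (f i).get hi = (f j).get hj) : i = j :=
  f.inj (Option.get_mem hi) (h ▸ Option.get_mem hj)

/-- Injectivity of `f` makes the sum a partial norm sum of `x` over the image of `s`; indices where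
`f` is undefined contribute 0. -/
theorem PEquiv.sum_norm_rpow_le (f : ι ≃. ι) (x : lp (fun _ : ι => ℂ) 2) (s : Finset ι) :
    ∑ i ∈ s, ‖(f i).elim 0 x‖ ^ (2 : ℝ≥0∞).toReal ≤ ‖x‖ ^ (2 : ℝ≥0∞).toReal := by
  classical
  have hinj : ∀ a a' : ι, ∀ b, b ∈ f a → b ∈ f a' → a = a' := fun a a' b h h' => f.inj h h'
  refine le_trans (le_of_eq ?_)
    (lp.sum_rpow_le_norm_rpow (by norm_num) x (s.filterMap f hinj))
  refine Finset.sum_bij_ne_zero (fun i _ hi => (f i).get ?_) ?_ ?_ ?_ ?_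
  · rw [Option.isSome_iff_ne_none]
    intro h
    simp [h] at hi
  · intro i hi h
    simp only [Finset.mem_filterMap]
    exact ⟨i, hi, by simp⟩
  · intro i hi h j hj h' hij
    exact f.eq_of_get_eq _ _ hij
  · intro j hj h
    simp only [Finset.mem_filterMap] at hj
    obtain ⟨i, hi, hij⟩ := hj
    exact ⟨i, hi, by simpa [hij] using h, by simp [hij]⟩
  · intro i hi h
    obtain ⟨j, hj⟩ : ∃ j, f i = some j := by
      rw [← Option.isSome_iff_exists, Option.isSome_iff_ne_none]
      intro h'
      simp [h'] at h
    simp [hj]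

/-- The contraction `(T_f x) i = x (f i)` of `ℓ²(ι)`, with value `0` where `f` is not defined. -/
noncomputable def PEquiv.l2Op (f : ι ≃. ι) :
    lp (fun _ : ι => ℂ) 2 →L[ℂ] lp (fun _ : ι => ℂ) 2 :=
  LinearMap.mkContinuous
    { toFun := fun x => ⟨fun i => (f i).elim 0 x,
        memℓp_gen' (C := ‖x‖ ^ (2 : ℝ≥0∞).toReal) (f.sum_norm_rpow_le x)⟩
      map_add' := by
        intro x y
        ext i
        change (f i).elim 0 (⇑(x + y) : ι → ℂ) = (f i).elim 0 (⇑x : ι → ℂ) + (f i).elim 0 (⇑y)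
        cases f i
        · exact (add_zero 0).symm
        · rfl
      map_smul' := by
        intro c x
        ext i
        change (f i).elim 0 (⇑(c • x) : ι → ℂ) = c • (f i).elim 0 (⇑x : ι → ℂ)
        cases f i <;> simp }
    1 (by
      intro x
      rw [one_mul]
      exact lp.norm_le_of_forall_sum_le (by norm_num) (norm_nonneg _) (f.sum_norm_rpow_le x))

theorem PEquiv.l2Op_apply (f : ι ≃. ι) (x : lp (fun _ : ι => ℂ) 2) (i : ι) :
    f.l2Op x i = (f i).elim 0 x := rfl

/-- Pulling back reverses composition: the left factor `f` is applied to the index first. -/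
theorem PEquiv.l2Op_mul (f g : ι ≃. ι) : f.l2Op * g.l2Op = (f.trans g).l2Op := by
  ext x i
  change f.l2Op (g.l2Op x) i = _
  rw [l2Op_apply, l2Op_apply, PEquiv.trans]
  change _ = ((f i).bind g).elim 0 x
  cases h : f i with
  | none => rfl
  | some j => exact g.l2Op_apply x j

/-- Both inner products are sums over the graph of `f`, indexed once by its domain and once by its
range. -/
theorem PEquiv.star_l2Op (f : ι ≃. ι) : star f.l2Op = f.symm.l2Op := by
  rw [ContinuousLinearMap.star_eq_adjoint, eq_comm, ContinuousLinearMap.eq_adjoint_iff]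
  intro x y
  rw [lp.inner_eq_tsum, lp.inner_eq_tsum]
  refine tsum_eq_tsum_of_ne_zero_bij (fun i => (f i.1).get ?_) ?_ ?_ ?_
  · rw [Option.isSome_iff_ne_none]
    intro h
    apply i.2
    simp [l2Op_apply, h]
  · intro i j hij
    exact Subtype.ext (f.eq_of_get_eq _ _ hij)
  · intro j hj
    cases h : f.symm j with
    | none => simp [l2Op_apply, h] at hj
    | some i =>
      have h' := f.eq_some_iff.1 h
      refine ⟨⟨i, ?_⟩, by simp [h']⟩
      simpa [l2Op_apply, h, h'] using hj
  · rintro ⟨i, hi⟩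
    obtain ⟨j, h⟩ : ∃ j, f i = some j := by
      rw [← Option.isSome_iff_exists, Option.isSome_iff_ne_none]
      intro h'
      simp [l2Op_apply, h'] at hi
    have h' := f.eq_some_iff.2 h
    simp [l2Op_apply, h, h']

open Classical in
/-- The projection of `ℓ²(ι)` onto the functions supported in `s`. -/
noncomputable def l2Proj (s : Set ι) : lp (fun _ : ι => ℂ) 2 →L[ℂ] lp (fun _ : ι => ℂ) 2 :=
  (PEquiv.ofSet s).l2Op

open Classical in
theorem l2Proj_apply (s : Set ι) (x : lp (fun _ : ι => ℂ) 2) (i : ι) :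
    l2Proj s x i = if i ∈ s then x i else 0 := by
  rw [l2Proj, PEquiv.l2Op_apply]
  change (if i ∈ s then some i else none).elim 0 x = _
  split_ifs <;> rfl

theorem star_l2Proj (s : Set ι) : star (l2Proj s) = l2Proj s := by
  rw [l2Proj, PEquiv.star_l2Op, PEquiv.ofSet_symm]

theorem l2Proj_mul (s t : Set ι) : l2Proj s * l2Proj t = l2Proj (s ∩ t) := by
  classical
  ext x i
  change l2Proj s (l2Proj t x) i = _
  rw [l2Proj_apply, l2Proj_apply, l2Proj_apply]
  by_cases h : i ∈ s <;> by_cases h' : i ∈ t <;> simp [h, h']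

theorem l2Proj_empty : l2Proj (∅ : Set ι) = 0 := by
  ext x i
  rw [l2Proj_apply]
  simp

theorem l2Proj_ne_zero {s : Set ι} (hs : s.Nonempty) : l2Proj s ≠ 0 := by
  classical
  obtain ⟨i, hi⟩ := hs
  intro h
  have h1 := l2Proj_apply s (lp.single 2 i (1 : ℂ)) i
  rw [h] at h1
  simp [hi] at h1

theorem isStarProjection_l2Proj (s : Set ι) : IsStarProjection (l2Proj s) :=
  ⟨by rw [IsIdempotentElem, l2Proj_mul, Set.inter_self], star_l2Proj s⟩

theorem l2Proj_sub {s t : Set ι} (h : s ⊆ t) : l2Proj t - l2Proj s = l2Proj (t \ s) := by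
  ext x i
  change l2Proj t x i - l2Proj s x i = _
  rw [l2Proj_apply, l2Proj_apply, l2Proj_apply]
  by_cases h1 : i ∈ s
  · simp [h1, h h1]
  · by_cases h2 : i ∈ t <;> simp [h1, h2]

theorem l2Proj_union {s t : Set ι} (h : Disjoint s t) :
    l2Proj (s ∪ t) = l2Proj s + l2Proj t := by
  rw [← sub_eq_iff_eq_add', l2Proj_sub Set.subset_union_left, Set.union_sdiff_cancel_left]
  exact h.le_bot

theorem sum_l2Proj {κ : Type*} (E : Finset κ) (D : κ → Set ι)
    (hD : (E : Set κ).PairwiseDisjoint D) :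
    ∑ a ∈ E, l2Proj (D a) = l2Proj (⋃ a ∈ E, D a) := by
  classical
  induction E using Finset.induction_on with
  | empty => simp [l2Proj_empty]
  | insert a E ha ih =>
    rw [Finset.sum_insert ha, ih (hD.subset (by simp)), Finset.set_biUnion_insert, l2Proj_union]
    rw [Set.disjoint_iUnion₂_right]
    intro b hb
    exact hD (by simp) (by simp [hb]) (by rintro rfl; exact ha hb)

theorem l2Op_mul_star (f : ι ≃. ι) : f.l2Op * star f.l2Op = l2Proj {i | (f i).isSome} := by
  rw [PEquiv.star_l2Op, PEquiv.l2Op_mul, PEquiv.self_trans_symm, l2Proj]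
  congr

theorem star_l2Op_mul (f : ι ≃. ι) : star f.l2Op * f.l2Op = l2Proj {i | (f.symm i).isSome} := by
  rw [PEquiv.star_l2Op, PEquiv.l2Op_mul, PEquiv.symm_trans_self, l2Proj]
  congr

theorem cstarLE_l2Proj {s t : Set ι} (h : s ⊆ t) : DiGraph.CStarLE (l2Proj s) (l2Proj t) :=
  ⟨l2Proj (t \ s), by rw [l2Proj_sub h, star_l2Proj, l2Proj_mul, Set.inter_self]⟩

end PartialPermutation

namespace DiGraph

/-! ### Hereditary saturated sets of vertices and simplicity -/

section HereditarySaturated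

universe u w

variable {V : Type u} {Ar : Type w} (G : DiGraph V Ar)

/-- A set of vertices is hereditary when no arrow leaves it. -/
def IsHereditary (H : Set V) : Prop := ∀ a, G.src a ∈ H → G.rng a ∈ H

/-- A set of vertices is saturated when it contains every regular vertex all of whose arrows
end in the set. -/
def IsSaturated (H : Set V) : Prop :=
  ∀ v, v ∉ G.singularVertices → (∀ a, G.src a = v → G.rng a ∈ H) → v ∈ H

/-- Copies of `ℕ` indexed by the arrows `a` leaving `v` with range outside `H` tile a copy
of `ℕ` attached to `v`. -/
theorem exists_tiling [Countable Ar] (H : Set V) : ∃ e : Ar → ℕ → ℕ,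
    (∀ a a' n n', G.rng a ∉ H → G.rng a' ∉ H → G.src a = G.src a' → e a n = e a' n' →
      a = a' ∧ n = n') ∧
    (∀ a k, G.rng a ∉ H → ∃ a' n, G.rng a' ∉ H ∧ G.src a' = G.src a ∧ e a' n = k) := by
  classical
  -- A non-empty countable set times `ℕ` is countably infinite, so finite and infinite emitters are
  -- treated alike.
  have h (v : V) (hv : Nonempty {a // G.src a = v ∧ G.rng a ∉ H}) :
      Nonempty ({a // G.src a = v ∧ G.rng a ∉ H} × ℕ ≃ ℕ) := nonempty_equiv_of_countable
  let e' (a : Ar) (ha : G.rng a ∉ H) := (h (G.src a) ⟨⟨a, rfl, ha⟩⟩).some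
  -- The bijections chosen at `a` and `a'` belong to propositionally equal vertices; this identifies
  -- them.
  have key (a a' : Ar) (ha : G.rng a ∉ H) (ha' : G.rng a' ∉ H) (haa' : G.src a' = G.src a)
      (n : ℕ) : e' a' ha' (⟨a', rfl, ha'⟩, n) = e' a ha (⟨a', haa', ha'⟩, n) := by
    have : ∀ (v : V) (hv : G.src a' = v) (h1 h2),
        (h (G.src a') h1).some (⟨a', rfl, ha'⟩, n) = (h v h2).some (⟨a', hv, ha'⟩, n) := by
      rintro v rfl h1 h2
      rfl
    exact this _ haa' ⟨⟨a', rfl, ha'⟩⟩ ⟨⟨a, rfl, ha⟩⟩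
  refine ⟨fun a n => if ha : G.rng a ∉ H then e' a ha (⟨a, rfl, ha⟩, n) else 0, ?_, ?_⟩
  · intro a a' n n' ha ha' haa' heq
    simp only [dif_pos ha, dif_pos ha'] at heq
    rw [key a a' ha ha' haa'.symm] at heq
    have := (e' a ha).injective heq
    simpa using this
  · intro a k ha
    obtain ⟨⟨⟨a', h1, h2⟩, n⟩, hn⟩ := (e' a ha).surjective k
    refine ⟨a', n, h2, h1, ?_⟩
    simp only [dif_pos h2]
    rw [key a a' ha h2 h1, hn]

/-- A representation of the relations in which `P v = 0` precisely for `v ∈ H`. -/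
theorem exists_CKRep [Countable V] [Countable Ar] {H : Set V} (hH : G.IsHereditary H)
    (hsat : G.IsSaturated H) : ∃ R : G.CKRep, ∀ v, R.P v = 0 ↔ v ∈ H := by
  classical
  obtain ⟨e, he, he'⟩ := G.exists_tiling H
  obtain ⟨enc, henc⟩ := exists_injective_nat V
  -- Each vertex outside `H` owns one column of `ℕ × ℕ`. Below, `σ a` maps the tile of `a` in the
  -- column of its source onto the full column of its range, and is empty when that range is in `H`.
  let X (v : V) : Set (ℕ × ℕ) := {i | i.1 = enc v ∧ v ∉ H}
  let σ (a : Ar) : ℕ × ℕ ≃. ℕ × ℕ :=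
    { toFun := fun i => if h : G.rng a ∉ H ∧ ∃ n, i = (enc (G.src a), e a n) then
          some (enc (G.rng a), h.2.choose) else none
      invFun := fun j => if G.rng a ∉ H ∧ j.1 = enc (G.rng a) then
          some (enc (G.src a), e a j.2) else none
      inv := by
        rintro i ⟨j1, j2⟩
        constructor
        · intro h
          split_ifs at h with h1
          · obtain ⟨h2, rfl⟩ := h1
            simp only [Option.some.injEq] at h
            have hex : G.rng a ∉ H ∧ ∃ n, i = (enc (G.src a), e a n) := ⟨h2, j2, h.symm⟩
            rw [dif_pos hex]
            have h3 := h.trans hex.2.choose_spec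
            have h4 := (he a a _ _ h2 h2 rfl (Prod.ext_iff.1 h3).2).2
            rw [← h4]
        · intro h
          split_ifs at h with h1
          · have h3 := h1.2.choose_spec
            simp only [Option.some.injEq, Prod.mk.injEq] at h
            rw [if_pos ⟨h1.1, h.1.symm⟩, ← h.2]
            exact congrArg some h3.symm }
  let D (a : Ar) : Set (ℕ × ℕ) := {i | (σ a i).isSome}
  have hD (a : Ar) (i : ℕ × ℕ) : i ∈ D a ↔ G.rng a ∉ H ∧ ∃ n, i = (enc (G.src a), e a n) := by
    change (dite _ _ _ : Option (ℕ × ℕ)).isSome ↔ _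
    split_ifs with h
    · simp [h]
    · simp only [Option.isSome_none, Bool.false_eq_true, false_iff]
      exact h
  have hR (a : Ar) : {i | ((σ a).symm i).isSome} = X (G.rng a) := by
    ext j
    change (ite _ _ _ : Option (ℕ × ℕ)).isSome ↔ _
    split_ifs with h
    · simp [X, h]
    · simp only [Option.isSome_none, Bool.false_eq_true, false_iff]
      exact fun h' => h ⟨h'.2, h'.1⟩
  have hDX (a : Ar) : D a ⊆ X (G.src a) := by
    intro i hi
    obtain ⟨h1, n, rfl⟩ := (hD a i).1 hi
    exact ⟨rfl, fun h => h1 (hH a h)⟩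
  have hdisj : Pairwise (Function.onFun Disjoint D) := by
    intro a a' hne
    rw [Function.onFun, Set.disjoint_left]
    intro i hi hi'
    obtain ⟨h1, n, rfl⟩ := (hD a i).1 hi
    obtain ⟨h1', n', h2'⟩ := (hD a' _).1 hi'
    obtain ⟨h3, h4⟩ := Prod.ext_iff.1 h2'
    exact hne (he a a' n n' h1 h1' (henc h3) h4).1
  have hsum (E : Finset Ar) : ∑ a ∈ E, (σ a).l2Op * star (σ a).l2Op = l2Proj (⋃ a ∈ E, D a) := by
    simp_rw [l2Op_mul_star]
    exact sum_l2Proj E D (hdisj.set_pairwise _)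
  have hsub (v : V) (E : Finset Ar) (hE : (E : Set Ar) ⊆ G.out v) : ⋃ a ∈ E, D a ⊆ X v := by
    refine Set.iUnion₂_subset fun a ha => ?_
    have := hE ha
    rw [← show G.src a = v from this]
    exact hDX a
  refine ⟨{ alg := lp (fun _ : ℕ × ℕ => ℂ) 2 →L[ℂ] lp (fun _ : ℕ × ℕ => ℂ) 2
            S := fun a => (σ a).l2Op
            P := fun v => l2Proj (X v)
            rel := ⟨?_, ?_, ?_, ?_, ?_, ?_⟩ }, ?_⟩
  · exact fun v => isStarProjection_l2Proj _
  · intro v v' hvv'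
    rw [l2Proj_mul, ← l2Proj_empty]
    congr 1
    rw [← Set.disjoint_iff_inter_eq_empty, Set.disjoint_left]
    exact fun i h h' => hvv' (henc (h.1.symm.trans h'.1))
  · intro a
    rw [star_l2Op_mul, hR]
  · intro a
    rw [l2Op_mul_star]
    exact cstarLE_l2Proj (hDX a)
  · intro v E hE
    rw [hsum]
    exact cstarLE_l2Proj (hsub v E hE)
  · intro v hv
    rw [hsum]
    congr 1
    refine Set.Subset.antisymm ?_ (hsub v _ (by simp))
    rintro ⟨i1, i2⟩ ⟨rfl, hvH⟩
    -- Saturation provides an arrow that leaves to the complement of `H`, so the column of `v`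
    -- really is tiled.
    have : ∃ a, G.src a = v ∧ G.rng a ∉ H := by
      by_contra! hcon
      exact hvH (hsat v hv hcon)
    obtain ⟨a, rfl, ha⟩ := this
    obtain ⟨a', n, h1, h2, h3⟩ := he' a i2 ha
    simp only [Set.mem_iUnion]
    refine ⟨a', by simpa using show a' ∈ G.out (G.src a) from h2, (hD a' _).2 ⟨h1, n, ?_⟩⟩
    rw [h2, h3]
  · intro v
    change l2Proj (X v) = 0 ↔ _
    constructor
    · intro h
      by_contra hv
      have hX : (X v).Nonempty := ⟨(enc v, 0), rfl, hv⟩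
      exact l2Proj_ne_zero hX h
    · intro hv
      rw [← l2Proj_empty]
      congr 1
      ext i
      simp [X, hv]

/-- The canonical map from the graph C*-algebra to the algebra of a representation. -/
noncomputable def toRep (R : G.CKRep) : G.GraphCStar →ₙ+* R.alg where
  toFun x := x.1 R
  map_mul' _ _ := rfl
  map_zero' := rfl
  map_add' _ _ := rfl

theorem continuous_toRep (R : G.CKRep) : Continuous (G.toRep R) :=
  (lp.lipschitzWith_one_eval ∞ R).continuous.comp continuous_subtype_val

/-- The projection `P_v` of the graph C*-algebra. -/
noncomputable def projection (v : V) : G.GraphCStar :=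
  ⟨G.univP v, subset_closure (NonUnitalStarAlgebra.subset_adjoin ℂ _ (Or.inr ⟨v, rfl⟩))⟩

theorem toRep_projection (R : G.CKRep) (v : V) : G.toRep R (G.projection v) = R.P v := rfl

/-- When the graph C*-algebra is simple, there are only trivial hereditary saturated sets. -/
theorem eq_univ_of_isHereditary_of_isSaturated [Countable V] [Countable Ar]
    (hsimple : IsSimpleCStar G.GraphCStar) {H : Set V} (hH : G.IsHereditary H)
    (hsat : G.IsSaturated H) (hne : H.Nonempty) : H = Set.univ := by
  obtain ⟨R, hR⟩ := G.exists_CKRep hH hsat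
  -- The empty set is saturated because a regular vertex emits an arrow; its representation shows
  -- that no `P_v` vanishes in the graph algebra, which excludes a zero kernel.
  obtain ⟨R₀, hR₀⟩ := G.exists_CKRep (H := ∅) (fun a h => h.elim) (by
    intro v hv h
    apply hv
    left
    by_contra hcon
    obtain ⟨a, ha⟩ := Set.nonempty_iff_ne_empty.2 hcon
    exact h a ha)
  have hclosed : IsClosed {x | x ∈ TwoSidedIdeal.ker (G.toRep R)} := by
    simp_rw [TwoSidedIdeal.mem_ker]
    exact isClosed_singleton.preimage (G.continuous_toRep R)
  obtain ⟨v, hv⟩ := hne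
  rcases hsimple _ hclosed with h | h
  · have h1 : G.projection v ∈ TwoSidedIdeal.ker (G.toRep R) := by
      rw [TwoSidedIdeal.mem_ker, toRep_projection, hR]
      exact hv
    rw [h, TwoSidedIdeal.mem_bot] at h1
    have h2 := G.toRep_projection R₀ v
    rw [h1, map_zero] at h2
    exact ((hR₀ v).1 h2.symm).elim
  · ext w
    simp only [Set.mem_univ, iff_true]
    have h1 : G.projection w ∈ TwoSidedIdeal.ker (G.toRep R) := by
      rw [h]
      trivial
    rw [TwoSidedIdeal.mem_ker, toRep_projection, hR] at h1
    exact h1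

end HereditarySaturated

/-! ### Reachability -/

section Reachability

variable {V Ar : Type*} (G : DiGraph V Ar)

/-- There is an arrow from `v` to `w`. -/
def Arrow (v w : V) : Prop := ∃ a, G.src a = v ∧ G.rng a = w

variable {G}

theorem IsPath.reflTransGen {l : List Ar} {v w : V} (h : G.IsPath v l w) :
    Relation.ReflTransGen G.Arrow v w := by
  induction l generalizing v with
  | nil => exact h ▸ .refl
  | cons a l ih => exact .head ⟨a, h.1, rfl⟩ (ih h.2)

theorem exists_isPath_of_reflTransGen {v w : V} (h : Relation.ReflTransGen G.Arrow v w) :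
    ∃ l, G.IsPath v l w := by
  induction h using Relation.ReflTransGen.head_induction_on with
  | refl => exact ⟨[], rfl⟩
  | head h _ ih =>
    obtain ⟨a, h1, rfl⟩ := h
    obtain ⟨l, hl⟩ := ih
    exact ⟨a :: l, h1, hl⟩

theorem mem_nonWandering_iff {v : V} :
    v ∈ G.nonWandering ↔ ∃ a, G.src a = v ∧ Relation.ReflTransGen G.Arrow (G.rng a) v := by
  constructor
  · rintro ⟨⟨s, l, r, h⟩, h1, h2, h3⟩
    obtain rfl : s = v := h2
    obtain rfl : r = s := h3
    cases l with
    | nil => simp at h1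
    | cons a l => exact ⟨a, h.1, IsPath.reflTransGen h.2⟩
  · rintro ⟨a, h1, h2⟩
    obtain ⟨l, hl⟩ := exists_isPath_of_reflTransGen h2
    exact ⟨⟨v, a :: l, v, h1, hl⟩, by simp, rfl, rfl⟩

variable [Countable V] [Countable Ar]

/-- In a graph with simple C*-algebra every vertex is connected to every non-wandering vertex. -/
theorem reflTransGen_of_mem_nonWandering (hsimple : IsSimpleCStar G.GraphCStar) {v : V}
    (hv : v ∈ G.nonWandering) (x : V) : Relation.ReflTransGen G.Arrow x v := by
  by_contra hx
  -- The vertices that do not reach `v` form a hereditary set. It is saturated because `v` itself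
  -- emits an arrow that leads back to `v`. If non-empty it would contain `v`.
  have h := G.eq_univ_of_isHereditary_of_isSaturated hsimple
    (H := {y | ¬ Relation.ReflTransGen G.Arrow y v})
    (fun a ha h => ha (.head ⟨a, rfl, rfl⟩ h)) ?_ ⟨x, hx⟩
  · exact (h ▸ Set.mem_univ v : v ∈ {y | ¬ Relation.ReflTransGen G.Arrow y v}) .refl
  · intro y _ hy h
    rcases h.cases_head with rfl | ⟨z, ⟨a, h1, rfl⟩, h2⟩
    · obtain ⟨a, h1, h2⟩ := mem_nonWandering_iff.1 hv
      exact hy a h1 h2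
    · exact hy a h1 h2

/-- The range of `a` leads back to the non-wandering source of `a`, and `a` closes the loop. -/
theorem rng_mem_nonWandering (hsimple : IsSimpleCStar G.GraphCStar) {a : Ar}
    (ha : G.src a ∈ G.nonWandering) : G.rng a ∈ G.nonWandering := by
  have h := reflTransGen_of_mem_nonWandering hsimple ha (G.rng a)
  rcases h.cases_head with h | ⟨z, ⟨b, h1, rfl⟩, h2⟩
  · rw [h]
    exact ha
  · exact mem_nonWandering_iff.2 ⟨b, h1, h2.tail ⟨a, rfl, rfl⟩⟩

variable (G) in
/-- The saturation of the set of non-wandering vertices. -/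
inductive SaturationNW : V → Prop
  | base {v : V} (hv : v ∈ G.nonWandering) : SaturationNW v
  | step {v : V} (hv : v ∉ G.singularVertices) (h : ∀ a, G.src a = v → SaturationNW (G.rng a)) :
      SaturationNW v

/-- When the C*-algebra is simple, the vertex set is the saturation of the set of
non-wandering vertices. -/
theorem induction_from_nonWandering (hsimple : IsSimpleCStar G.GraphCStar)
    (hne : G.nonWandering.Nonempty) {p : V → Prop} (base : ∀ v ∈ G.nonWandering, p v)
    (step : ∀ v, v ∉ G.nonWandering → v ∉ G.singularVertices → (∀ a, G.src a = v → p (G.rng a)) →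
      p v) (v : V) : p v := by
  have h := G.eq_univ_of_isHereditary_of_isSaturated hsimple (H := {v | G.SaturationNW v}) ?_
    (fun v hv h => SaturationNW.step hv h) (hne.mono fun v hv => SaturationNW.base hv)
  · have hv : G.SaturationNW v := (h ▸ Set.mem_univ v : v ∈ {v | G.SaturationNW v})
    clear h
    induction hv with
    | base hv => exact base _ hv
    | @step v hv _ ih =>
      by_cases h : v ∈ G.nonWandering
      · exact base _ h
      · exact step v h hv ih
  · intro a ha
    generalize hv : G.src a = v at ha
    cases (show G.SaturationNW v from ha) with
    | base h => exact .base (rng_mem_nonWandering hsimple (hv ▸ h))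
    | step _ h => exact h a hv

end Reachability

/-! ### The transfer operator -/

section Transfer

variable {V Ar : Type*} (G : DiGraph V Ar) (F : Ar → ℝ) (β : ℝ)

/-- The weight `e^{-β F(a)}` of an arrow. -/
noncomputable def arrowWeight (F : Ar → ℝ) (β : ℝ) (a : Ar) : ℝ≥0∞ :=
  ENNReal.ofReal (Real.exp (-β * F a))

theorem arrowWeight_ne_zero (a : Ar) : arrowWeight F β a ≠ 0 := by
  simp [arrowWeight, Real.exp_pos]

theorem arrowWeight_ne_top (a : Ar) : arrowWeight F β a ≠ ∞ := ENNReal.ofReal_ne_top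

/-- The action of the matrix `A(β)` on vectors. -/
noncomputable def transfer (u : V → ℝ≥0∞) (v : V) : ℝ≥0∞ := ∑' w, G.matA F β v w * u w

theorem transfer_eq_tsum_out (u : V → ℝ≥0∞) (v : V) :
    G.transfer F β u v = ∑' a : {a // G.src a = v}, arrowWeight F β a * u (G.rng a) := by
  let e : (Σ w, {a // G.src a = v ∧ G.rng a = w}) ≃ {a // G.src a = v} :=
    { toFun := fun x => ⟨x.2.1, x.2.2.1⟩
      invFun := fun a => ⟨G.rng a, a.1, a.2, rfl⟩
      left_inv := by
        rintro ⟨w, a, h, rfl⟩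
        rfl
      right_inv := fun a => rfl }
  rw [← e.tsum_eq, ENNReal.tsum_sigma', transfer]
  refine tsum_congr fun w => ?_
  rw [matA, ← ENNReal.tsum_mul_right]
  refine tsum_congr fun a => ?_
  change _ = arrowWeight F β a.1 * u (G.rng a.1)
  rw [a.2.2]
  rfl

theorem mul_le_transfer (u : V → ℝ≥0∞) (a : Ar) :
    arrowWeight F β a * u (G.rng a) ≤ G.transfer F β u (G.src a) := by
  rw [transfer_eq_tsum_out]
  exact ENNReal.le_tsum (f := fun b : {b // G.src b = G.src a} =>
    arrowWeight F β b * u (G.rng b)) ⟨a, rfl⟩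

variable {F β} in
theorem transfer_congr {u u' : V → ℝ≥0∞} {v : V}
    (h : ∀ a, G.src a = v → u (G.rng a) = u' (G.rng a)) :
    G.transfer F β u v = G.transfer F β u' v := by
  rw [transfer_eq_tsum_out, transfer_eq_tsum_out]
  exact tsum_congr fun a => by rw [h a a.2]

theorem transfer_add (u u' : V → ℝ≥0∞) :
    G.transfer F β (u + u') = G.transfer F β u + G.transfer F β u' := by
  ext v
  simp only [transfer, Pi.add_apply, mul_add]
  exact ENNReal.tsum_add

theorem transfer_smul (c : ℝ≥0∞) (u : V → ℝ≥0∞) :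
    G.transfer F β (c • u) = c • G.transfer F β u := by
  ext v
  simp only [transfer, Pi.smul_apply, smul_eq_mul, ← ENNReal.tsum_mul_left]
  exact tsum_congr fun w => by ring

theorem transfer_mono {u u' : V → ℝ≥0∞} (h : u ≤ u') :
    G.transfer F β u ≤ G.transfer F β u' :=
  fun _ => ENNReal.tsum_le_tsum fun w => mul_le_mul_right (h w) _

theorem transfer_tsum {ι : Type*} (u : ι → V → ℝ≥0∞) (v : V) :
    G.transfer F β (fun w => ∑' i, u i w) v = ∑' i, G.transfer F β (u i) v := by
  simp only [transfer, ← ENNReal.tsum_mul_left]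
  exact ENNReal.tsum_comm

theorem iterate_transfer_add (n : ℕ) (u u' : V → ℝ≥0∞) :
    (G.transfer F β)^[n] (u + u') = (G.transfer F β)^[n] u + (G.transfer F β)^[n] u' := by
  induction n generalizing u u' with
  | zero => rfl
  | succ n ih => rw [Function.iterate_succ_apply, transfer_add, ih]; rfl

theorem tsum_powA_mul (n : ℕ) (u : V → ℝ≥0∞) (v : V) :
    ∑' w, G.powA F β n v w * u w = (G.transfer F β)^[n] u v := by
  classical
  induction n generalizing v with
  | zero =>
    rw [tsum_eq_single v]
    · simp [powA]
    · intro w hw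
      simp [powA, hw.symm]
  | succ n ih =>
    rw [Function.iterate_succ_apply', transfer]
    simp_rw [← ih, powA, ← ENNReal.tsum_mul_left, ← ENNReal.tsum_mul_right]
    rw [ENNReal.tsum_comm]
    simp_rw [mul_assoc]

theorem powA_mul_le (n : ℕ) (u : V → ℝ≥0∞) (v w : V) :
    G.powA F β n v w * u w ≤ (G.transfer F β)^[n] u v := by
  rw [← tsum_powA_mul]
  exact ENNReal.le_tsum (f := fun w => G.powA F β n v w * u w) w

theorem powA_eq_iterate (n k : ℕ) (v w : V) :
    G.powA F β (n + k) v w = (G.transfer F β)^[n] (fun x => G.powA F β k x w) v := by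
  induction n generalizing v with
  | zero => simp
  | succ n ih =>
    rw [Function.iterate_succ_apply', transfer, Nat.add_right_comm, powA]
    simp_rw [ih]

theorem powA_mul_powA_le (n k : ℕ) (v x w : V) :
    G.powA F β n v x * G.powA F β k x w ≤ G.powA F β (n + k) v w := by
  rw [powA_eq_iterate]
  exact G.powA_mul_le F β n (fun x => G.powA F β k x w) v x

variable {G} in
theorem exists_powA_ne_zero {v w : V} (h : Relation.ReflTransGen G.Arrow v w) :
    ∃ n, G.powA F β n v w ≠ 0 := by
  classical
  induction h using Relation.ReflTransGen.head_induction_on with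
  | refl => exact ⟨0, by simp [powA]⟩
  | head h _ ih =>
    obtain ⟨a, rfl, rfl⟩ := h
    obtain ⟨n, hn⟩ := ih
    refine ⟨n + 1, fun h0 => ?_⟩
    have := G.mul_le_transfer F β (fun x => G.powA F β n x w) a
    rw [transfer, ← powA, h0, nonpos_iff_eq_zero, mul_eq_zero] at this
    exact this.elim (arrowWeight_ne_zero F β a) hn

variable {G F β} in
theorem SumDiverges.tsum_powA {v w : V} (hv : G.SumDiverges F β v)
    (h : Relation.ReflTransGen G.Arrow v w) : ∑' n, G.powA F β n v w = ∞ := by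
  obtain ⟨k, hk⟩ := exists_powA_ne_zero F β h
  have h1 : (∑' n, G.powA F β n v v) * G.powA F β k v w ≤ ∑' n, G.powA F β n v w := by
    rw [← ENNReal.tsum_mul_right]
    refine (ENNReal.tsum_le_tsum fun n => G.powA_mul_powA_le F β n k v v w).trans ?_
    exact ENNReal.tsum_comp_le_tsum_of_injective (add_left_injective k) _
  rw [hv, ENNReal.top_mul hk, top_le_iff] at h1
  exact h1

variable {G F β} in
-- Riesz decomposition with defect `d`, truncated at time `N`.
theorem eq_iterate_transfer_add_sum {u d : V → ℝ≥0∞} (hd : u = G.transfer F β u + d) (N : ℕ) :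
    u = (G.transfer F β)^[N] u + ∑ n ∈ Finset.range N, (G.transfer F β)^[n] d := by
  induction N with
  | zero => simp
  | succ N ih =>
    rw [Finset.sum_range_succ, Function.iterate_succ_apply, add_comm _ ((G.transfer F β)^[N] d),
      ← add_assoc, ← iterate_transfer_add, ← hd]
    exact ih

variable {G F β} in
theorem iterate_transfer_le {u : V → ℝ≥0∞} (hu : G.transfer F β u ≤ u) (n : ℕ) :
    (G.transfer F β)^[n] u ≤ u := by
  induction n with
  | zero => exact le_rfl
  | succ n ih =>
    rw [Function.iterate_succ_apply']
    exact (G.transfer_mono F β ih).trans hu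

variable {G F β} in
/-- Superharmonic vectors are harmonic at the vertices that can be reached from a recurrent one. -/
theorem SumDiverges.transfer_eq {v w : V} (hv : G.SumDiverges F β v) {u : V → ℝ≥0∞}
    (hu : G.transfer F β u ≤ u) (huv : u v ≠ ∞) (h : Relation.ReflTransGen G.Arrow v w) :
    G.transfer F β u w = u w := by
  refine (hu w).antisymm ?_
  have hd : u = G.transfer F β u + (u - G.transfer F β u) := (add_tsub_cancel_of_le hu).symm
  set d := u - G.transfer F β u with hd'
  -- The Green sum from `v` to `w` times the defect at `w` is at most `u v`, which is finite; an
  -- infinite Green sum forces the defect to be 0.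
  have h1 : (∑' n, G.powA F β n v w) * d w ≤ u v := by
    rw [← ENNReal.tsum_mul_right]
    refine ENNReal.tsum_le_of_sum_range_le fun N => ?_
    rw [eq_iterate_transfer_add_sum hd N]
    simp only [Pi.add_apply, Finset.sum_apply]
    exact le_add_left (Finset.sum_le_sum fun n _ => G.powA_mul_le F β n d v w)
  rw [hv.tsum_powA h] at h1
  by_contra hcon
  have h2 : d w ≠ 0 := by
    rw [hd', Pi.sub_apply, Ne, tsub_eq_zero_iff_le]
    exact hcon
  rw [ENNReal.top_mul h2, top_le_iff] at h1
  exact huv h1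

variable {G F β} in
-- The minimum of `u` and `u'` is superharmonic, so it and `u` are both harmonic at all vertices
-- reachable from `v`. Their difference is non-negative, harmonic there and zero at `v`, and such a
-- zero spreads along arrows.
theorem SumDiverges.le_of_superharmonic {v w : V} (hv : G.SumDiverges F β v)
    {u u' : V → ℝ≥0∞} (hu : G.transfer F β u ≤ u) (hu' : G.transfer F β u' ≤ u')
    (hfin : ∀ x, u x ≠ ∞) (huv : u v = u' v) (h : Relation.ReflTransGen G.Arrow v w) :
    u w ≤ u' w := by
  have hm : G.transfer F β (u ⊓ u') ≤ u ⊓ u' :=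
    le_inf ((G.transfer_mono F β inf_le_left).trans hu)
      ((G.transfer_mono F β inf_le_right).trans hu')
  have hmfin (x : V) : (u ⊓ u') x ≠ ∞ := ne_top_of_le_ne_top (hfin x) inf_le_left
  have hd : u = u ⊓ u' + (u - u ⊓ u') := (add_tsub_cancel_of_le inf_le_left).symm
  have hdx (x : V) (hx : Relation.ReflTransGen G.Arrow v x) :
      G.transfer F β (u - u ⊓ u') x = (u - u ⊓ u') x := by
    have h1 := hv.transfer_eq hu (hfin v) hx
    have h2 := hv.transfer_eq hm (hmfin v) hx
    rw [hd, transfer_add] at h1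
    simp only [Pi.add_apply] at h1
    rw [h2] at h1
    exact (ENNReal.add_right_inj (hmfin x)).1 h1
  have h0 : (u - u ⊓ u') w = 0 := by
    induction h with
    | refl => simp [huv]
    | tail h1 h2 ih =>
      obtain ⟨a, rfl, rfl⟩ := h2
      have h3 := G.mul_le_transfer F β (u - u ⊓ u') a
      rw [hdx _ h1, ih, nonpos_iff_eq_zero, mul_eq_zero] at h3
      exact h3.resolve_left (arrowWeight_ne_zero F β a)
  rw [Pi.sub_apply, tsub_eq_zero_iff_le] at h0
  exact h0.trans inf_le_right

end Transfer

/-! ### Uniqueness of almost harmonic vectors in the recurrent case -/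

section Uniqueness

variable {V Ar : Type*} {G : DiGraph V Ar} {F : Ar → ℝ} {β : ℝ} {φ φ' : V → ℝ≥0}

theorem IsHarmonic.isAlmostHarmonic (h : G.IsHarmonic F β φ) : G.IsAlmostHarmonic F β φ :=
  ⟨h.ne_zero, fun v => (h.eq v).le, fun v _ => h.eq v⟩

theorem IsAlmostHarmonic.transfer_le (h : G.IsAlmostHarmonic F β φ) :
    G.transfer F β (fun v => (φ v : ℝ≥0∞)) ≤ fun v => (φ v : ℝ≥0∞) := h.le

theorem eq_zero_of_transfer_le {u : V → ℝ≥0∞} (hu : G.transfer F β u ≤ u) {v w : V}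
    (h : Relation.ReflTransGen G.Arrow v w) (hv : u v = 0) : u w = 0 := by
  induction h with
  | refl => exact hv
  | tail h1 h2 ih =>
    obtain ⟨a, rfl, rfl⟩ := h2
    have h3 := (G.mul_le_transfer F β u a).trans (hu _)
    rw [ih, nonpos_iff_eq_zero, mul_eq_zero] at h3
    exact h3.resolve_left (arrowWeight_ne_zero F β a)

variable [Countable V] [Countable Ar]

/-- Vectors that are harmonic at the wandering vertices are determined by their restriction to
the set of non-wandering vertices. -/
theorem eq_of_eqOn_nonWandering (hsimple : IsSimpleCStar G.GraphCStar)
    (hne : G.nonWandering.Nonempty) {u u' : V → ℝ≥0∞}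
    (hu : ∀ v, v ∉ G.nonWandering → v ∉ G.singularVertices → G.transfer F β u v = u v)
    (hu' : ∀ v, v ∉ G.nonWandering → v ∉ G.singularVertices → G.transfer F β u' v = u' v)
    (h : ∀ v ∈ G.nonWandering, u v = u' v) : u = u' := by
  ext v
  induction v using induction_from_nonWandering hsimple hne with
  | base v hv => exact h v hv
  | step v h1 h2 ih => rw [← hu v h1 h2, ← hu' v h1 h2, G.transfer_congr ih]

/-- A zero spreads along arrows to every non-wandering vertex, and from there to all vertices by
saturation. -/
theorem IsAlmostHarmonic.apply_ne_zero (hsimple : IsSimpleCStar G.GraphCStar)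
    (hne : G.nonWandering.Nonempty) (h : G.IsAlmostHarmonic F β φ) (v : V) : φ v ≠ 0 := by
  intro h0
  have h1 : (fun v => (φ v : ℝ≥0∞)) = 0 := by
    refine eq_of_eqOn_nonWandering hsimple hne (F := F) (β := β) (fun v _ hv => h.eq v hv)
      (fun v _ _ => by simp [transfer]) ?_
    intro w hw
    exact eq_zero_of_transfer_le h.transfer_le (reflTransGen_of_mem_nonWandering hsimple hw v)
      (by simpa using h0)
  apply h.ne_zero
  ext v
  simpa using congrFun h1 v

/-- After scaling to agree at `v`, comparison in both directions gives equality on the non-wandering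
vertices, which determine the vectors. -/
theorem SumDiverges.exists_eq_smul (hsimple : IsSimpleCStar G.GraphCStar) {v : V}
    (hv : v ∈ G.nonWandering) (hdiv : G.SumDiverges F β v) (h : G.IsAlmostHarmonic F β φ)
    (h' : G.IsAlmostHarmonic F β φ') : ∃ c : ℝ≥0, 0 < c ∧ φ' = c • φ := by
  have hne : G.nonWandering.Nonempty := ⟨v, hv⟩
  have h0 := h.apply_ne_zero hsimple hne v
  have h0' := h'.apply_ne_zero hsimple hne v
  refine ⟨φ' v / φ v, by positivity, ?_⟩
  set c := φ' v / φ v with hc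
  have hsm : G.transfer F β ((c : ℝ≥0∞) • fun v => (φ v : ℝ≥0∞)) ≤
      ((c : ℝ≥0∞) • fun v => (φ v : ℝ≥0∞)) := by
    rw [transfer_smul]
    exact fun w => mul_le_mul_right (h.le w) _
  have hcv : (φ' v : ℝ≥0∞) = c * φ v := by
    rw [← ENNReal.coe_mul, hc, div_mul_cancel₀ _ h0]
  have key : (fun v => (φ' v : ℝ≥0∞)) = (c : ℝ≥0∞) • fun v => (φ v : ℝ≥0∞) := by
    refine eq_of_eqOn_nonWandering hsimple hne (F := F) (β := β) (fun v _ hv => h'.eq v hv) ?_ ?_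
    · intro v _ hv
      rw [transfer_smul, Pi.smul_apply, Pi.smul_apply]
      congr 1
      exact h.eq v hv
    · intro w hw
      have hr := reflTransGen_of_mem_nonWandering hsimple hw v
      exact (hdiv.le_of_superharmonic h'.transfer_le hsm (fun _ => ENNReal.coe_ne_top) hcv
        hr).antisymm (hdiv.le_of_superharmonic hsm h'.transfer_le
          (fun _ => ENNReal.mul_ne_top ENNReal.coe_ne_top ENNReal.coe_ne_top) hcv.symm hr)
  ext w
  have := congrFun key w
  simp only [Pi.smul_apply, smul_eq_mul] at this
  exact_mod_cast this

end Uniqueness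

end DiGraph

/-! ### Root test and Abel summation in `[0, ∞]` -/

section Sequences

open Filter Topology

theorem ENNReal.eventually_le_pow_of_limsup_lt {x : ℕ → ℝ≥0∞} {r : ℝ≥0∞}
    (h : limsup (fun n : ℕ => x n ^ (1 / (n : ℝ))) atTop < r) : ∀ᶠ n in atTop, x n ≤ r ^ n := by
  filter_upwards [eventually_lt_of_limsup_lt h, eventually_ge_atTop 1] with n hn hn1
  have hn0 : (n : ℝ) ≠ 0 := by positivity
  calc x n = (x n ^ (1 / (n : ℝ))) ^ n := by
        rw [← ENNReal.rpow_natCast, ← ENNReal.rpow_mul, one_div_mul_cancel hn0, ENNReal.rpow_one]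
    _ ≤ r ^ n := by gcongr

theorem ENNReal.limsup_le_of_eventually_le_mul_pow {x : ℕ → ℝ≥0∞} {C r : ℝ≥0∞} (hC : C ≠ ∞)
    (h : ∀ᶠ n in atTop, x n ≤ C * r ^ n) :
    limsup (fun n : ℕ => x n ^ (1 / (n : ℝ))) atTop ≤ r := by
  lift C to ℝ≥0 using hC
  -- `C` may be 0; replacing it by `max C 1` makes the `n`-th roots tend to 1.
  have h1 : Tendsto (fun n : ℕ => (max C 1) ^ (1 / (n : ℝ))) atTop (𝓝 1) := by
    have := (NNReal.continuousAt_rpow (x := max C 1) (y := 0) (Or.inl (by positivity))).tendsto.comp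
      ((tendsto_const_nhds (x := max C 1)).prodMk_nhds
        (tendsto_one_div_atTop_nhds_zero_nat (𝕜 := ℝ)))
    simpa [Function.comp_def] using this
  have h2 : Tendsto (fun n : ℕ => (((max C 1) ^ (1 / (n : ℝ)) : ℝ≥0) : ℝ≥0∞) * r) atTop (𝓝 r) := by
    have := ENNReal.Tendsto.mul_const (b := r) (ENNReal.tendsto_coe.2 h1) (Or.inl (by simp))
    simpa using this
  rw [← h2.limsup_eq]
  refine limsup_le_limsup ?_
  filter_upwards [h, eventually_ge_atTop 1] with n hn hn1
  have hn0 : (n : ℝ) ≠ 0 := by positivity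
  calc x n ^ (1 / (n : ℝ)) ≤ (((max C 1 : ℝ≥0) : ℝ≥0∞) * r ^ n) ^ (1 / (n : ℝ)) := by
        gcongr
        refine hn.trans ?_
        gcongr
        exact le_max_left _ _
    _ = _ := by
        rw [ENNReal.mul_rpow_of_nonneg _ _ (by positivity), ← ENNReal.rpow_natCast r n,
          ← ENNReal.rpow_mul, mul_one_div_cancel hn0, ENNReal.rpow_one,
          ENNReal.coe_rpow_of_ne_zero (by positivity)]

theorem ENNReal.tsum_ne_top_of_eventually_le_pow {x : ℕ → ℝ≥0∞} {q : ℝ≥0∞} (hx : ∀ n, x n ≠ ∞)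
    (hq : q < 1) (h : ∀ᶠ n in atTop, x n ≤ q ^ n) : ∑' n, x n ≠ ∞ := by
  obtain ⟨N, hN⟩ := eventually_atTop.1 h
  have h1 : ∑' n, x n ≤ ∑' n, (q ^ n + if n ∈ Finset.range N then x n else 0) := by
    refine ENNReal.tsum_le_tsum fun n => ?_
    by_cases hn : n < N
    · simp [hn]
    · exact (hN n (not_lt.1 hn)).trans le_self_add
  refine ne_top_of_le_ne_top ?_ h1
  rw [ENNReal.tsum_add, ENNReal.tsum_geometric, tsum_eq_sum (s := Finset.range N)
    (fun n hn => if_neg hn), Finset.sum_congr rfl (fun n hn => if_pos hn)]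
  refine ENNReal.add_ne_top.2 ⟨?_, ENNReal.sum_ne_top.2 fun n _ => hx n⟩
  simpa [tsub_eq_zero_iff_le] using hq

/-- Abel summation: each finite partial sum is continuous as `s` increases to 1. The free exponent
`e` covers both `s ^ n` and `s ^ (n + 1)`. -/
theorem ENNReal.tsum_le_of_forall_lt_one {x : ℕ → ℝ≥0∞} (e : ℕ → ℕ) {M : ℝ≥0∞}
    (h : ∀ s < 1, ∑' n, x n * s ^ e n ≤ M) : ∑' n, x n ≤ M := by
  refine ENNReal.tsum_le_of_sum_range_le fun N => ?_
  have h1 : Tendsto (fun s : ℝ≥0∞ => ∑ n ∈ Finset.range N, x n * s ^ e n) (𝓝[<] 1)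
      (𝓝 (∑ n ∈ Finset.range N, x n)) := by
    refine tendsto_finsetSum _ fun n _ => ?_
    have h2 : Tendsto (fun s : ℝ≥0∞ => s ^ e n) (𝓝[<] 1) (𝓝 1) := by
      have := (ENNReal.continuous_pow (e n)).tendsto 1
      rw [one_pow] at this
      exact this.mono_left nhdsWithin_le_nhds
    simpa using ENNReal.Tendsto.const_mul (a := x n) h2 (Or.inl one_ne_zero)
  have : (𝓝[<] (1 : ℝ≥0∞)).NeBot := ENNReal.nhdsLT_neBot
  refine le_of_tendsto h1 ?_
  filter_upwards [self_mem_nhdsWithin] with s hs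
  exact (ENNReal.sum_le_tsum _).trans (h s hs)

theorem ENNReal.tsum_sum_antidiagonal (f g : ℕ → ℝ≥0∞) :
    ∑' n, ∑ p ∈ Finset.HasAntidiagonal.antidiagonal n, f p.1 * g p.2 = (∑' n, f n) * ∑' n, g n := by
  simp_rw [← ENNReal.tsum_mul_right, ← ENNReal.tsum_mul_left]
  rw [← ENNReal.tsum_prod (f := fun m n => f m * g n),
    ← (Finset.HasAntidiagonal.sigmaAntidiagonalEquivProd (A := ℕ)).tsum_eq, ENNReal.tsum_sigma']
  refine tsum_congr fun n => ?_
  rw [tsum_fintype, ← Finset.sum_coe_sort]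
  rfl

end Sequences

namespace DiGraph

/-! ### Dependence of the recurrence conditions on the vertex -/

section Solidarity

open Filter Topology

variable {V Ar : Type*} {G : DiGraph V Ar} {F : Ar → ℝ} {β : ℝ}

theorem powA_zero_self (v : V) : G.powA F β 0 v v = 1 := by simp [powA]

/-- A loop at `w` becomes a loop at `v` by inserting it between a path from `v` to `w` and one back.
-/
theorem powA_conj_le (k n l : ℕ) (v w : V) :
    G.powA F β n w w * (G.powA F β k v w * G.powA F β l w v) ≤ G.powA F β (n + (k + l)) v v := by
  have h1 := G.powA_mul_powA_le F β k n v w w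
  have h2 := G.powA_mul_powA_le F β (k + n) l v w v
  calc _ = G.powA F β k v w * G.powA F β n w w * G.powA F β l w v := by ring
    _ ≤ G.powA F β (k + n) v w * G.powA F β l w v := by gcongr
    _ ≤ G.powA F β (k + n + l) v v := h2
    _ = _ := by congr 1; ring

theorem SumDiverges.of_communicating {v w : V} (hvw : Relation.ReflTransGen G.Arrow v w)
    (hwv : Relation.ReflTransGen G.Arrow w v) (h : G.SumDiverges F β w) :
    G.SumDiverges F β v := by
  obtain ⟨k, hk⟩ := exists_powA_ne_zero F β hvw
  obtain ⟨l, hl⟩ := exists_powA_ne_zero F β hwv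
  have h1 : (∑' n, G.powA F β n w w) * (G.powA F β k v w * G.powA F β l w v) ≤
      ∑' n, G.powA F β n v v := by
    rw [← ENNReal.tsum_mul_right]
    refine (ENNReal.tsum_le_tsum fun n => powA_conj_le k n l v w).trans ?_
    exact ENNReal.tsum_comp_le_tsum_of_injective (add_left_injective (k + l)) _
  rw [h, ENNReal.top_mul (mul_ne_zero hk hl), top_le_iff] at h1
  exact h1

theorem limsup_powA_le_of_communicating {v w : V} (hvw : Relation.ReflTransGen G.Arrow v w)
    (hwv : Relation.ReflTransGen G.Arrow w v) :
    limsup (fun n : ℕ => G.powA F β n w w ^ (1 / (n : ℝ))) atTop ≤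
      limsup (fun n : ℕ => G.powA F β n v v ^ (1 / (n : ℝ))) atTop := by
  obtain ⟨k, hk⟩ := exists_powA_ne_zero F β hvw
  obtain ⟨l, hl⟩ := exists_powA_ne_zero F β hwv
  refine le_of_forall_gt_imp_ge_of_dense fun r hr => ?_
  rcases eq_or_ne r ∞ with rfl | hr'
  · exact le_top
  have hc := mul_ne_zero hk hl
  refine ENNReal.limsup_le_of_eventually_le_mul_pow
    (C := r ^ (k + l) / (G.powA F β k v w * G.powA F β l w v))
    (ENNReal.div_ne_top (ENNReal.pow_ne_top hr') hc) ?_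
  have h1 := (tendsto_add_atTop_nat (k + l)).eventually (ENNReal.eventually_le_pow_of_limsup_lt hr)
  filter_upwards [h1] with n hn
  have h2 := (powA_conj_le (G := G) (F := F) (β := β) k n l v w).trans hn
  calc G.powA F β n w w ≤ r ^ (n + (k + l)) / (G.powA F β k v w * G.powA F β l w v) :=
        (ENNReal.le_div_iff_mul_le (Or.inl hc) (Or.inr (ENNReal.pow_ne_top hr'))).2 h2
    _ = _ := by rw [pow_add, div_eq_mul_inv, div_eq_mul_inv]; ring

end Solidarity

/-! ### First passage vectors -/

section FirstPassage

open Filter Topology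

variable {V Ar : Type*} (G : DiGraph V Ar) (F : Ar → ℝ) (β : ℝ)

open Classical in
/-- `firstPassage v n w` is the total weight of the paths of length `n + 1` from `w` to `v` which
do not visit `v` at the intermediate times. -/
noncomputable def firstPassage (v : V) : ℕ → V → ℝ≥0∞
  | 0 => G.transfer F β (Pi.single v 1)
  | n + 1 => G.transfer F β (Function.update (firstPassage v n) v 0)

theorem transfer_finset_sum {ι : Type*} (s : Finset ι) (u : ι → V → ℝ≥0∞) :
    G.transfer F β (∑ i ∈ s, u i) = ∑ i ∈ s, G.transfer F β (u i) := by
  classical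
  induction s using Finset.induction_on with
  | empty =>
    ext v
    simp [transfer]
  | insert a s ha ih => rw [Finset.sum_insert ha, Finset.sum_insert ha, transfer_add, ih]

/-- Split a path at its first visit to `v` at a positive time. Since `firstPassage` with index `i`
has length `i + 1`, the remaining loop has length `n - i`. -/
theorem powA_succ_eq_sum_firstPassage (v : V) (n : ℕ) (w : V) :
    G.powA F β (n + 1) w v =
      ∑ p ∈ Finset.HasAntidiagonal.antidiagonal n, G.firstPassage F β v p.1 w * G.powA F β p.2 v v := by
  classical
  induction n generalizing w with
  | zero =>
    rw [powA]
    simp only [Finset.Nat.antidiagonal_zero, Finset.sum_singleton, powA_zero_self, mul_one]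
    rw [firstPassage, transfer]
    refine tsum_congr fun x => ?_
    congr 1
    rw [powA, Pi.single_apply]
  | succ n ih =>
    have h1 : (fun x => G.powA F β (n + 1) x v) = G.powA F β (n + 1) v v • Pi.single v 1 +
        ∑ p ∈ Finset.HasAntidiagonal.antidiagonal n,
          G.powA F β p.2 v v • Function.update (G.firstPassage F β v p.1) v 0 := by
      ext x
      by_cases hx : x = v
      · subst hx
        simp
      · simp only [Pi.add_apply, Pi.smul_apply, Finset.sum_apply, smul_eq_mul,
          Function.update_of_ne hx, Pi.single_eq_of_ne hx, mul_zero, zero_add]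
        rw [ih]
        exact Finset.sum_congr rfl fun p _ => mul_comm _ _
    rw [powA, ← transfer, h1, Finset.Nat.sum_antidiagonal_succ, transfer_add, transfer_smul,
      transfer_finset_sum]
    simp only [transfer_smul, Pi.add_apply, Pi.smul_apply, Finset.sum_apply, smul_eq_mul]
    rw [mul_comm]
    congr 1
    exact Finset.sum_congr rfl fun p _ => mul_comm _ _

/-- The generating function form of the first-visit decomposition, written additively so that
infinite values are allowed. -/
theorem renewal_equation (v : V) (s : ℝ≥0∞) :
    ∑' n, G.powA F β n v v * s ^ n =
      1 + (∑' n, G.firstPassage F β v n v * s ^ (n + 1)) * ∑' n, G.powA F β n v v * s ^ n := by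
  rw [← ENNReal.tsum_sum_antidiagonal, tsum_eq_zero_add' ENNReal.summable, powA_zero_self]
  simp only [pow_zero, mul_one]
  congr 1
  refine tsum_congr fun n => ?_
  rw [powA_succ_eq_sum_firstPassage, Finset.sum_mul]
  refine Finset.sum_congr rfl fun p hp => ?_
  rw [← Finset.HasAntidiagonal.mem_antidiagonal.1 hp]
  ring

variable {G F β}

/-- An infinite entry at `n` makes the entries at all positive multiples of `n` infinite, whereas
the limsup bounds late entries by `2 ^ m`. -/
theorem LimsupEqOne.powA_ne_top {v : V} (h : G.LimsupEqOne F β v) (n : ℕ) :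
    G.powA F β n v v ≠ ∞ := by
  intro hn
  have h0 : n ≠ 0 := by
    rintro rfl
    simp [powA_zero_self] at hn
  have h1 (k : ℕ) : G.powA F β (n * (k + 1)) v v = ∞ := by
    induction k with
    | zero => simpa using hn
    | succ k ih =>
      have := G.powA_mul_powA_le F β (n * (k + 1)) n v v v
      rw [ih, hn, ENNReal.top_mul_top, top_le_iff] at this
      rw [← this]
      congr 1
  have h2 := ENNReal.eventually_le_pow_of_limsup_lt (r := 2)
    ((show limsup (fun n : ℕ => G.powA F β n v v ^ (1 / (n : ℝ))) atTop = 1 from h).trans_lt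
      ENNReal.one_lt_two)
  obtain ⟨N, hN⟩ := eventually_atTop.1 h2
  have h3 := hN (n * (N + 1)) (by nlinarith [Nat.pos_of_ne_zero h0])
  rw [h1, top_le_iff] at h3
  exact ENNReal.pow_ne_top (by simp) h3

theorem LimsupEqOne.tsum_ne_top {v : V} (h : G.LimsupEqOne F β v) {s : ℝ≥0∞} (hs : s < 1) :
    ∑' n, G.powA F β n v v * s ^ n ≠ ∞ := by
  have h1 : 1 < 1 / s := by simpa using hs
  obtain ⟨r, hr1, hr⟩ := exists_between h1
  refine ENNReal.tsum_ne_top_of_eventually_le_pow (q := r * s)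
    (fun n => ENNReal.mul_ne_top (h.powA_ne_top n) (ENNReal.pow_ne_top hs.ne_top))
    (ENNReal.mul_lt_of_lt_div hr) ?_
  have h2 := ENNReal.eventually_le_pow_of_limsup_lt (r := r)
    ((show limsup (fun n : ℕ => G.powA F β n v v ^ (1 / (n : ℝ))) atTop = 1 from h).trans_lt hr1)
  filter_upwards [h2] with n hn
  rw [mul_pow]
  gcongr

/-- At a recurrent vertex the return loops have total weight `1`. -/
theorem tsum_firstPassage_self {v : V} (hdiv : G.SumDiverges F β v) (hlim : G.LimsupEqOne F β v) :
    ∑' n, G.firstPassage F β v n v = 1 := by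
  apply le_antisymm
  -- If the return series exceeded 1 at some `s < 1`, the renewal equation would give `1 + B ≤ B`
  -- with `B` finite.
  · refine ENNReal.tsum_le_of_forall_lt_one (fun n => n + 1) fun s hs => ?_
    by_contra! hcon
    have h1 := G.renewal_equation F β v s
    have h2 := hlim.tsum_ne_top hs
    have h3 : 1 + ∑' n, G.powA F β n v v * s ^ n ≤ ∑' n, G.powA F β n v v * s ^ n := by
      conv_rhs => rw [h1]
      gcongr
      exact le_mul_of_one_le_left' hcon.le
    rw [add_comm] at h3
    exact (ENNReal.lt_add_right h2 one_ne_zero).not_ge h3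
  -- If the returns had total weight below 1, the renewal equation would bound the Green series
  -- uniformly in `s < 1`, against divergence.
  · by_contra! hcon
    have h4 : ∑' n, G.powA F β n v v ≤ (1 - ∑' n, G.firstPassage F β v n v)⁻¹ := by
      refine ENNReal.tsum_le_of_forall_lt_one (fun n => n) fun s hs => ?_
      have h1 := G.renewal_equation F β v s
      have h2 := hlim.tsum_ne_top hs
      set B := ∑' n, G.powA F β n v v * s ^ n
      have h3 : ∑' n, G.firstPassage F β v n v * s ^ (n + 1) ≤ ∑' n, G.firstPassage F β v n v :=
        ENNReal.tsum_le_tsum fun n => mul_le_of_le_one_right' (pow_le_one' hs.le _)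
      rw [ENNReal.le_inv_iff_mul_le, ENNReal.mul_sub (fun _ _ => h2), mul_one, tsub_le_iff_right]
      refine h1.le.trans ?_
      rw [mul_comm B]
      gcongr
    rw [hdiv, top_le_iff, ENNReal.inv_eq_top, tsub_eq_zero_iff_le] at h4
    exact hcon.not_ge h4

/-- Because the value at `v` is 1, the vector equals the unit mass at `v` plus its restriction off
`v`. The transfer operator turns these pieces into the first term and the tail of the same series.
-/
theorem transfer_tsum_firstPassage {v : V} (h : ∑' n, G.firstPassage F β v n v = 1) :
    G.transfer F β (fun w => ∑' n, G.firstPassage F β v n w) =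
      fun w => ∑' n, G.firstPassage F β v n w := by
  classical
  have h1 : (fun w => ∑' n, G.firstPassage F β v n w) = Pi.single v 1 +
      fun w => ∑' n, Function.update (G.firstPassage F β v n) v 0 w := by
    ext w
    by_cases hw : w = v
    · subst hw
      simp [h]
    · simp [Function.update_of_ne hw, Pi.single_eq_of_ne hw]
  ext w
  conv_lhs => rw [h1, transfer_add, Pi.add_apply, transfer_tsum]
  exact (tsum_eq_zero_add' (f := fun n => G.firstPassage F β v n w) ENNReal.summable).symm

/-- In the recurrent case there is a harmonic vector. -/
theorem SumDiverges.exists_isHarmonic [Countable V] [Countable Ar]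
    (hsimple : IsSimpleCStar G.GraphCStar) {v : V} (hv : v ∈ G.nonWandering)
    (hdiv : G.SumDiverges F β v) (hlim : G.LimsupEqOne F β v) : ∃ φ, G.IsHarmonic F β φ := by
  have h1 := tsum_firstPassage_self hdiv hlim
  have hT := transfer_tsum_firstPassage h1
  set u : V → ℝ≥0∞ := fun w => ∑' n, G.firstPassage F β v n w with hu
  -- The value 1 at `v` bounds the values at vertices reachable from `v`; at the remaining regular
  -- vertices harmonicity is a finite sum.
  have hfin (w : V) : u w ≠ ∞ := by
    induction w using induction_from_nonWandering hsimple ⟨v, hv⟩ with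
    | base w hw =>
      intro h
      obtain ⟨n, hn⟩ := exists_powA_ne_zero F β (reflTransGen_of_mem_nonWandering hsimple hw v)
      have h2 := (G.powA_mul_le F β n u v w).trans (iterate_transfer_le hT.le n v)
      rw [h, ENNReal.mul_top hn, show u v = 1 from h1] at h2
      simp at h2
    | step w _ hw ih =>
      rw [← hT, transfer_eq_tsum_out]
      have : Finite {a // G.src a = w} := G.finite_out hw
      have := Fintype.ofFinite {a // G.src a = w}
      rw [tsum_fintype]
      exact ENNReal.sum_ne_top.2 fun a _ =>
        ENNReal.mul_ne_top (arrowWeight_ne_top F β a) (ih a a.2)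
  refine ⟨fun w => (u w).toNNReal, ?_, ?_⟩
  · intro h
    have h2 := congrFun h v
    rw [show u v = 1 from h1] at h2
    simp at h2
  · intro w
    simp only [ENNReal.coe_toNNReal (hfin _)]
    exact congrFun hT w

/-- The recurrence conditions hold when the sum diverges and a positive superharmonic
vector exists. -/
theorem SumDiverges.limsupEqOne {v : V} (hdiv : G.SumDiverges F β v) {u : V → ℝ≥0∞}
    (hu : G.transfer F β u ≤ u) (h0 : u v ≠ 0) (hfin : u v ≠ ∞) : G.LimsupEqOne F β v := by
  have hle (n : ℕ) : G.powA F β n v v ≤ 1 := by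
    have h1 := (G.powA_mul_le F β n u v v).trans (iterate_transfer_le hu n v)
    rw [← ENNReal.le_div_iff_mul_le (Or.inl h0) (Or.inl hfin), ENNReal.div_self h0 hfin] at h1
    exact h1
  apply le_antisymm
  · exact ENNReal.limsup_le_of_eventually_le_mul_pow (C := 1) (by simp)
      (Eventually.of_forall fun n => by simpa using hle n)
  · by_contra! hcon
    obtain ⟨r, hr, hr1⟩ := exists_between hcon
    exact ENNReal.tsum_ne_top_of_eventually_le_pow
      (fun n => ne_top_of_le_ne_top ENNReal.one_ne_top (hle n)) hr1
      (ENNReal.eventually_le_pow_of_limsup_lt hr) hdiv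

end FirstPassage

/-! ### Cylinder sets -/

section Cylinders

open MeasureTheory

variable {V Ar : Type*} {G : DiGraph V Ar}

theorem isPath_append {v w : V} {l l' : List Ar} :
    G.IsPath v (l ++ l') w ↔ ∃ x, G.IsPath v l x ∧ G.IsPath x l' w := by
  induction l generalizing v with
  | nil => simp [IsPath]
  | cons a l ih => simp [IsPath, ih, and_assoc]

/-- The path of length `0` at a vertex. -/
def FinPath.vertex (G : DiGraph V Ar) (v : V) : G.FinPath := ⟨v, [], v, rfl⟩

/-- The extension of a path by an arrow. -/
def FinPath.snoc (μ : G.FinPath) (a : Ar) (h : G.src a = μ.range) : G.FinPath :=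
  ⟨μ.source, μ.arrows ++ [a], G.rng a, isPath_append.2 ⟨μ.range, μ.isPath, h, rfl⟩⟩

theorem FinPath.length_snoc (μ : G.FinPath) (a : Ar) (h : G.src a = μ.range) :
    (μ.snoc a h).arrows.length = μ.arrows.length + 1 := by simp [snoc]

theorem FinPath.exists_eq_snoc (μ : G.FinPath) (h : μ.arrows ≠ []) :
    ∃ (μ' : G.FinPath) (a : Ar) (ha : G.src a = μ'.range), μ = μ'.snoc a ha := by
  obtain ⟨v, l, w, hp⟩ := μ
  rcases List.eq_nil_or_concat l with rfl | ⟨l', a, rfl⟩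
  · exact absurd rfl h
  · rw [List.concat_eq_append] at hp
    obtain ⟨x, h1, h2, rfl⟩ := isPath_append.1 hp
    exact ⟨⟨v, l', x, h1⟩, a, h2, by simp [snoc]⟩

instance [Countable V] [Countable Ar] : Countable G.FinPath := by
  refine Function.Injective.countable
    (f := fun μ : G.FinPath => (μ.source, μ.arrows, μ.range)) ?_
  rintro ⟨v, l, w, h⟩ ⟨v', l', w', h'⟩ heq
  simp only [Prod.mk.injEq] at heq
  obtain ⟨rfl, rfl, rfl⟩ := heq
  rfl

theorem src_eq_of_isPath (p : G.InfPath) {l : List Ar} {v w : V} (h : G.IsPath v l w) (k : ℕ)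
    (hk : G.src (p.1 k) = v) (hl : ∀ (i : ℕ) (hi : i < l.length), p.1 (k + i) = l[i]) :
    G.src (p.1 (k + l.length)) = w := by
  induction l generalizing v k with
  | nil => exact hk.trans h
  | cons a l ih =>
    have h0 : p.1 k = a := hl 0 (by simp)
    have h1 := ih h.2 (k + 1) (by rw [← p.2 k, h0]) (fun i hi => by
      have := hl (i + 1) (by simpa using hi)
      rw [List.getElem_cons_succ] at this
      rw [← this, add_assoc, add_comm 1])
    rw [List.length_cons, ← h1, add_assoc, add_comm 1]

theorem src_eq_range {μ : G.FinPath} {p : G.InfPath} (hp : p ∈ G.cylinder μ) :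
    G.src (p.1 μ.arrows.length) = μ.range := by
  have := src_eq_of_isPath p μ.isPath 0 hp.1 (fun i hi => by rw [zero_add]; exact hp.2 i hi)
  rwa [zero_add] at this

theorem mem_cylinder_vertex {v : V} {p : G.InfPath} :
    p ∈ G.cylinder (.vertex G v) ↔ G.src (p.1 0) = v := by
  simp [cylinder, FinPath.vertex]

theorem mem_cylinder_snoc {μ : G.FinPath} {a : Ar} (h : G.src a = μ.range) {p : G.InfPath} :
    p ∈ G.cylinder (μ.snoc a h) ↔ p ∈ G.cylinder μ ∧ p.1 μ.arrows.length = a := by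
  constructor
  · rintro ⟨h1, h2⟩
    refine ⟨⟨h1, fun i hi => ?_⟩, ?_⟩
    · rw [h2 i (by rw [FinPath.length_snoc]; omega)]
      exact List.getElem_append_left hi
    · rw [h2 _ (by rw [FinPath.length_snoc]; omega)]
      exact List.getElem_concat_length rfl _
  · rintro ⟨⟨h1, h2⟩, h3⟩
    refine ⟨h1, fun i hi => ?_⟩
    rw [FinPath.length_snoc] at hi
    rcases Nat.lt_succ_iff_lt_or_eq.1 hi with hi' | rfl
    · rw [h2 i hi']
      exact (List.getElem_append_left hi').symm
    · rw [h3]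
      exact (List.getElem_concat_length rfl _).symm

theorem cylinder_eq_iUnion (μ : G.FinPath) :
    G.cylinder μ = ⋃ a : {a // G.src a = μ.range}, G.cylinder (μ.snoc a a.2) := by
  ext p
  simp only [Set.mem_iUnion, mem_cylinder_snoc]
  constructor
  · exact fun hp => ⟨⟨p.1 μ.arrows.length, src_eq_range hp⟩, hp, rfl⟩
  · exact fun ⟨_, hp, _⟩ => hp

theorem exists_mem_cylinder (p : G.InfPath) (n : ℕ) :
    ∃ μ : G.FinPath, μ.arrows.length = n ∧ p ∈ G.cylinder μ := by
  induction n with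
  | zero => exact ⟨.vertex G (G.src (p.1 0)), rfl, mem_cylinder_vertex.2 rfl⟩
  | succ n ih =>
    obtain ⟨μ, rfl, hμ⟩ := ih
    exact ⟨μ.snoc _ (src_eq_range hμ), μ.length_snoc _ _, (mem_cylinder_snoc _).2 ⟨hμ, rfl⟩⟩

theorem measurableSet_coord (i : ℕ) (S : Set Ar) : MeasurableSet {p : G.InfPath | p.1 i ∈ S} := by
  let : TopologicalSpace Ar := ⊥
  have : DiscreteTopology Ar := ⟨rfl⟩
  have h1 : Continuous fun p : G.InfPath => p.1 i :=
    (continuous_apply i).comp continuous_induced_dom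
  exact ((isOpen_discrete S).preimage h1).measurableSet

theorem measurableSet_cylinder (μ : G.FinPath) : MeasurableSet (G.cylinder μ) := by
  have h : G.cylinder μ = {p | p.1 0 ∈ {a | G.src a = μ.source}} ∩
      ⋂ (i : ℕ) (hi : i < μ.arrows.length), {p : G.InfPath | p.1 i ∈ ({μ.arrows[i]} : Set Ar)} := by
    ext p
    simp [cylinder]
  rw [h]
  exact (measurableSet_coord _ _).inter (MeasurableSet.iInter fun i => MeasurableSet.iInter
    fun hi => measurableSet_coord _ _)

theorem measure_cylinder_inter [Countable Ar] (m : Measure G.InfPath) (μ : G.FinPath)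
    {B : Set G.InfPath} (hB : MeasurableSet B) :
    m (G.cylinder μ ∩ B) =
      ∑' a : {a // G.src a = μ.range}, m (G.cylinder (μ.snoc a a.2) ∩ B) := by
  rw [cylinder_eq_iUnion μ, Set.iUnion_inter, measure_iUnion]
  · intro a b hab
    refine Set.disjoint_left.2 fun p hp hp' => hab (Subtype.ext ?_)
    exact ((mem_cylinder_snoc a.2).1 hp.1).2.symm.trans ((mem_cylinder_snoc b.2).1 hp'.1).2
  · exact fun a => (measurableSet_cylinder _).inter hB

end Cylinders

/-! ### Passage probabilities -/

section Passage

open MeasureTheory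

variable {V Ar : Type*} (G : DiGraph V Ar) (F : Ar → ℝ) (β : ℝ)

/-- The weight `e^{-β F(μ)}` of a finite path. -/
noncomputable def pathWeight (μ : G.FinPath) : ℝ≥0∞ :=
  ENNReal.ofReal (Real.exp (-β * (μ.arrows.map F).sum))

theorem pathWeight_vertex (v : V) : G.pathWeight F β (.vertex G v) = 1 := by
  simp [pathWeight, FinPath.vertex]

theorem pathWeight_snoc (μ : G.FinPath) (a : Ar) (h : G.src a = μ.range) :
    G.pathWeight F β (μ.snoc a h) = G.pathWeight F β μ * arrowWeight F β a := by
  rw [pathWeight, pathWeight, arrowWeight, ← ENNReal.ofReal_mul (Real.exp_nonneg _),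
    ← Real.exp_add]
  congr 2
  simp only [FinPath.snoc, List.map_append, List.map_cons, List.map_nil, List.sum_append,
    List.sum_cons, List.sum_nil]
  ring

/-- The paths which, after `k` arrows, run through `n` arrows from `S` followed by one from `R`. -/
def passage (S R : Set Ar) (k n : ℕ) : Set G.InfPath :=
  {p | (∀ i < n, p.1 (k + i) ∈ S) ∧ p.1 (k + n) ∈ R}

open Classical in
/-- The mass, with respect to the path measure of `u`, of the paths that start with `n` arrows
from `S` followed by one from `R`. -/
noncomputable def passageMass (S R : Set Ar) (u : V → ℝ≥0∞) : ℕ → V → ℝ≥0∞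
  | 0, v => ∑' a : {a // G.src a = v},
      arrowWeight F β a * if (a : Ar) ∈ R then u (G.rng a) else 0
  | n + 1, v => ∑' a : {a // G.src a = v},
      arrowWeight F β a * if (a : Ar) ∈ S then passageMass S R u n (G.rng a) else 0

variable {G F β}

theorem measurableSet_passage (S R : Set Ar) (k n : ℕ) : MeasurableSet (G.passage S R k n) := by
  have h : G.passage S R k n =
      (⋂ (i : ℕ) (_ : i < n), {p | p.1 (k + i) ∈ S}) ∩ {p | p.1 (k + n) ∈ R} := by
    ext p
    simp [passage]
  rw [h]
  exact (MeasurableSet.iInter fun i => MeasurableSet.iInter fun _ =>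
    measurableSet_coord _ _).inter (measurableSet_coord _ _)

/-- This is the mass of being at `w` at time `n`; harmonicity at `w` sums out the last arrow. -/
theorem passageMass_univ {φ : V → ℝ≥0} (hφ : G.IsHarmonic F β φ) (w : V) (n : ℕ) (v : V) :
    G.passageMass F β Set.univ {a | G.src a = w} (fun v => φ v) n v =
      G.powA F β n v w * φ w := by
  classical
  induction n generalizing v with
  | zero =>
    rw [passageMass, powA]
    by_cases h : v = w
    · subst h
      rw [if_pos rfl, one_mul, ← hφ.eq v, ← transfer, transfer_eq_tsum_out]
      refine tsum_congr fun a => ?_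
      rw [if_pos]
      exact a.2
    · rw [if_neg h, zero_mul]
      refine ENNReal.tsum_eq_zero.2 fun a => ?_
      rw [if_neg, mul_zero]
      exact fun h' => h (a.2.symm.trans h')
  | succ n ih =>
    simp only [passageMass, Set.mem_univ, if_true, ih]
    rw [← G.transfer_eq_tsum_out F β (fun x => G.powA F β n x w * (φ w : ℝ≥0∞)), transfer, powA,
      ← ENNReal.tsum_mul_right]
    exact tsum_congr fun x => by ring

theorem IsPathMeasure.measure_vertex {φ : V → ℝ≥0} {m : Measure G.InfPath} (hm : G.IsPathMeasure F β φ m)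
    (v : V) : m (G.cylinder (.vertex G v)) = φ v := by
  rw [hm, ← pathWeight, pathWeight_vertex, one_mul]
  rfl

theorem IsConservative.nonWandering_nonempty {φ : V → ℝ≥0}
    (h : G.IsConservative F β φ) :
    G.nonWandering.Nonempty := by
  by_contra hne
  obtain ⟨m, hm, h0⟩ := h.concentrated
  apply h.harmonic.ne_zero
  ext v
  have h1 : m (G.cylinder (.vertex G v)) = 0 :=
    measure_mono_null (t := (G.recurrentPaths)ᶜ) (fun p _ hp => hne hp.1) h0
  rw [hm.measure_vertex] at h1
  simpa using h1

/-- The index is the time of the first arrow from `R`, which is unique. -/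
theorem disjoint_passage (R : Set Ar) (k : ℕ) :
    Pairwise (Function.onFun Disjoint (G.passage Rᶜ R k)) := by
  intro n n' hne
  refine Set.disjoint_left.2 fun p hp hp' => ?_
  rcases lt_or_gt_of_ne hne with h | h
  · exact hp'.1 n h hp.2
  · exact hp.1 n' h hp'.2

open Classical in
-- First-step analysis of the mass that ever meets `R`: the first arrow is in `R`, or the question
-- restarts at its range.
theorem tsum_passageMass (R : Set Ar) (u : V → ℝ≥0∞) (v : V) :
    ∑' n, G.passageMass F β Rᶜ R u n v = ∑' a : {a // G.src a = v}, arrowWeight F β a *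
      if (a : Ar) ∈ R then u (G.rng a) else ∑' n, G.passageMass F β Rᶜ R u n (G.rng a) := by
  rw [tsum_eq_zero_add' ENNReal.summable]
  simp only [passageMass]
  rw [ENNReal.tsum_comm, ← ENNReal.tsum_add]
  refine tsum_congr fun a => ?_
  rw [ENNReal.tsum_mul_left, ← mul_add]
  congr 1
  by_cases h : (a : Ar) ∈ R <;> simp [h]

variable [Countable Ar]

/-- Induction on `n` for all cylinders at once: splitting off the next arrow moves it from the
passage into the cylinder. -/
theorem IsPathMeasure.measure_passage {φ : V → ℝ≥0} {m : Measure G.InfPath}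
    (hm : G.IsPathMeasure F β φ m) (S R : Set Ar) (n : ℕ) (μ : G.FinPath) :
    m (G.cylinder μ ∩ G.passage S R μ.arrows.length n) =
      G.pathWeight F β μ * G.passageMass F β S R (fun v => φ v) n μ.range := by
  classical
  induction n generalizing μ with
  | zero =>
    rw [measure_cylinder_inter m μ (measurableSet_passage _ _ _ _), passageMass,
      ← ENNReal.tsum_mul_left]
    refine tsum_congr fun a => ?_
    rw [← mul_assoc, ← pathWeight_snoc _ _ _ _ _ a.2]
    split_ifs with ha
    · rw [Set.inter_eq_self_of_subset_left]
      · exact hm _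
      · intro p hp
        refine ⟨by simp, ?_⟩
        rw [add_zero, ((mem_cylinder_snoc _).1 hp).2]
        exact ha
    · rw [mul_zero]
      convert measure_empty (μ := m)
      refine Set.disjoint_iff_inter_eq_empty.1 (Set.disjoint_left.2 fun p hp hp' => ha ?_)
      have := hp'.2
      rwa [add_zero, ((mem_cylinder_snoc _).1 hp).2] at this
  | succ n ih =>
    rw [measure_cylinder_inter m μ (measurableSet_passage _ _ _ _), passageMass,
      ← ENNReal.tsum_mul_left]
    refine tsum_congr fun a => ?_
    rw [← mul_assoc, ← pathWeight_snoc _ _ _ _ _ a.2]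
    split_ifs with ha
    · have h1 := ih (μ.snoc a a.2)
      rw [FinPath.length_snoc] at h1
      refine Eq.trans ?_ h1
      congr 1
      ext p
      refine and_congr_right fun hp => ?_
      have hpa := ((mem_cylinder_snoc a.2).1 hp).2
      constructor
      · rintro ⟨h2, h3⟩
        refine ⟨fun i hi => ?_, ?_⟩
        · rw [add_assoc, add_comm 1]
          exact h2 (i + 1) (by omega)
        · rwa [add_assoc, add_comm 1]
      · rintro ⟨h2, h3⟩
        refine ⟨fun i hi => ?_, ?_⟩
        · cases i with
          | zero => rw [add_zero, hpa]; exact ha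
          | succ i =>
            rw [add_comm i, ← add_assoc]
            exact h2 i (by omega)
        · rwa [add_comm n, ← add_assoc]
    · rw [mul_zero]
      convert measure_empty (μ := m)
      refine Set.disjoint_iff_inter_eq_empty.1 (Set.disjoint_left.2 fun p hp hp' => ha ?_)
      have := hp'.1 0 (by omega)
      rwa [add_zero, ((mem_cylinder_snoc _).1 hp).2] at this

theorem IsPathMeasure.measure_passage_vertex {φ : V → ℝ≥0} {m : Measure G.InfPath}
    (hm : G.IsPathMeasure F β φ m) (S R : Set Ar) (n : ℕ) (v : V) :
    m (G.cylinder (.vertex G v) ∩ G.passage S R 0 n) =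
      G.passageMass F β S R (fun v => φ v) n v := by
  have h := hm.measure_passage S R n (.vertex G v)
  rw [pathWeight_vertex, one_mul] at h
  exact h

theorem IsPathMeasure.measure_iUnion_passage {φ : V → ℝ≥0} {m : Measure G.InfPath}
    (hm : G.IsPathMeasure F β φ m) (R : Set Ar) (μ : G.FinPath) :
    m (G.cylinder μ ∩ ⋃ n, G.passage Rᶜ R μ.arrows.length n) =
      G.pathWeight F β μ * ∑' n, G.passageMass F β Rᶜ R (fun v => φ v) n μ.range := by
  rw [Set.inter_iUnion, measure_iUnion, ← ENNReal.tsum_mul_left]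
  · exact tsum_congr fun n => hm.measure_passage _ _ _ _
  · exact fun n n' hne => (disjoint_passage R _ hne).mono Set.inter_subset_right
      Set.inter_subset_right
  · exact fun n => (measurableSet_cylinder _).inter (measurableSet_passage _ _ _ _)

end Passage

/-! ### Conservative vectors are recurrent -/

section Recurrence

open MeasureTheory Filter

variable {V Ar : Type*} [Countable V] [Countable Ar] {G : DiGraph V Ar} {F : Ar → ℝ} {β : ℝ}
  {φ : V → ℝ≥0}

/-- The set of paths from `v` that are at `v` at time `n` has mass `A(β)^n_{v,v} φ_v`. If these were
summable, Borel–Cantelli would make infinitely many returns a null event, yet recurrent paths from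
`v` return infinitely often and carry the mass `φ_v ≠ 0`. -/
theorem IsConservative.sumDiverges (hsimple : IsSimpleCStar G.GraphCStar)
    (h : G.IsConservative F β φ) {v : V} (hv : v ∈ G.nonWandering) : G.SumDiverges F β v := by
  by_contra hfin
  obtain ⟨m, hm, h0⟩ := h.concentrated
  have hφ := h.harmonic.isAlmostHarmonic.apply_ne_zero hsimple ⟨v, hv⟩ v
  have h1 : ∑' n, m {p | p ∈ G.cylinder (.vertex G v) ∩
      G.passage Set.univ {a | G.src a = v} 0 n} ≠ ∞ := by
    simp only [Set.ofPred_mem_eq, hm.measure_passage_vertex, passageMass_univ h.harmonic,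
      ENNReal.tsum_mul_right]
    exact ENNReal.mul_ne_top hfin ENNReal.coe_ne_top
  have h2 := measure_setOfPred_frequently_eq_zero h1
  have h3 : m (G.cylinder (.vertex G v)) = 0 := by
    refine measure_mono_null ?_ (measure_union_null h0 h2)
    intro p hp
    by_cases hrec : p ∈ G.recurrentPaths
    · right
      obtain ⟨a, rfl, -⟩ := mem_nonWandering_iff.1 hv
      refine (Nat.frequently_atTop_iff_infinite.2 (hrec.2 a hv)).mono fun n hn => ?_
      refine ⟨hp, by simp, ?_⟩
      rw [zero_add]
      exact congrArg G.src hn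
    · exact Or.inl hrec
  rw [hm.measure_vertex] at h3
  exact hφ (by simpa using h3)

theorem IsConservative.limsupEqOne (hsimple : IsSimpleCStar G.GraphCStar)
    (h : G.IsConservative F β φ) {v : V} (hv : v ∈ G.nonWandering) : G.LimsupEqOne F β v :=
  (h.sumDiverges hsimple hv).limsupEqOne h.harmonic.isAlmostHarmonic.transfer_le
    (by simpa using h.harmonic.isAlmostHarmonic.apply_ne_zero hsimple ⟨v, hv⟩ v)
    ENNReal.coe_ne_top

/-! ### In the recurrent case harmonic vectors are conservative -/

/-- Let `u` be the mass of paths that ever use `a`. It is superharmonic and at most `φ`, and a gap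
at the range of `a` would be a defect at the recurrent source of `a`. Hence `u` and `φ` agree at
that range, and comparison of superharmonic vectors spreads the equality. -/
theorem IsPathMeasure.tsum_passageMass_eq (hsimple : IsSimpleCStar G.GraphCStar)
    {m : Measure G.InfPath} (hφ : G.IsHarmonic F β φ) (hm : G.IsPathMeasure F β φ m) {a : Ar}
    (ha : G.src a ∈ G.nonWandering) (hdiv : G.SumDiverges F β (G.src a)) :
    (fun v => ∑' n, G.passageMass F β {a}ᶜ {a} (fun v => φ v) n v) = fun v => (φ v : ℝ≥0∞) := by
  classical
  set u : V → ℝ≥0∞ := fun v => ∑' n, G.passageMass F β {a}ᶜ {a} (fun v => φ v) n v with hu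
  have hrec (v : V) : u v = ∑' b : {b // G.src b = v}, arrowWeight F β b *
      if (b : Ar) ∈ ({a} : Set Ar) then (φ (G.rng b) : ℝ≥0∞) else u (G.rng b) :=
    tsum_passageMass _ _ _
  have hle (v : V) : u v ≤ φ v := by
    have := hm.measure_iUnion_passage {a} (.vertex G v)
    rw [pathWeight_vertex, one_mul] at this
    rw [← hm.measure_vertex]
    exact this.symm.le.trans (measure_mono Set.inter_subset_left)
  have hfin (v : V) : u v ≠ ∞ := ne_top_of_le_ne_top ENNReal.coe_ne_top (hle v)
  have hterm (b : Ar) : arrowWeight F β b * u (G.rng b) ≤ arrowWeight F β b *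
      if b ∈ ({a} : Set Ar) then (φ (G.rng b) : ℝ≥0∞) else u (G.rng b) := by
    gcongr
    split_ifs
    · exact hle _
    · exact le_rfl
  have hsuper : G.transfer F β u ≤ u := by
    intro v
    rw [hrec v, transfer_eq_tsum_out]
    exact ENNReal.tsum_le_tsum fun b => hterm b
  have hra : u (G.rng a) = φ (G.rng a) := by
    refine (hle _).antisymm ?_
    by_contra! hcon
    have h1 := hdiv.transfer_eq hsuper (hfin _) .refl
    refine absurd h1 (ne_of_lt ?_)
    rw [hrec (G.src a)]
    rw [transfer_eq_tsum_out] at h1 ⊢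
    refine ENNReal.tsum_lt_tsum (i := ⟨a, rfl⟩) (h1 ▸ hfin _) (fun b => hterm b) ?_
    simp only [Set.mem_singleton_iff, if_true]
    exact (ENNReal.mul_lt_mul_iff_right (arrowWeight_ne_zero F β a)
      (arrowWeight_ne_top F β a)).2 hcon
  have hra' := rng_mem_nonWandering hsimple ha
  have hdiv' : G.SumDiverges F β (G.rng a) := hdiv.of_communicating
    (reflTransGen_of_mem_nonWandering hsimple ha _)
    (reflTransGen_of_mem_nonWandering hsimple hra' _)
  refine eq_of_eqOn_nonWandering hsimple ⟨_, ha⟩ (F := F) (β := β) ?_ (fun v _ _ => hφ.eq v) ?_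
  -- `a` starts at a non-wandering vertex, so at a wandering vertex the first-step equation is plain
  -- harmonicity.
  · intro v hv _
    rw [hrec v, transfer_eq_tsum_out]
    refine tsum_congr fun b => ?_
    rw [if_neg]
    rintro (h : (b : Ar) = a)
    exact hv (by rw [← b.2, h]; exact ha)
  · intro v hv
    exact (hle v).antisymm (hdiv'.le_of_superharmonic hφ.isAlmostHarmonic.transfer_le hsuper
      (fun _ => ENNReal.coe_ne_top) hra.symm (reflTransGen_of_mem_nonWandering hsimple hv _))

/-- A non-recurrent path stops using some arrow with non-wandering source after a time `N`. It then
lies in a cylinder of length `N + 1` without any later passage through that arrow, and there are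
countably many such null sets. -/
theorem IsPathMeasure.measure_compl_recurrentPaths (hsimple : IsSimpleCStar G.GraphCStar)
    {m : Measure G.InfPath} (hφ : G.IsHarmonic F β φ) (hm : G.IsPathMeasure F β φ m)
    (hne : G.nonWandering.Nonempty) (hdiv : ∀ v ∈ G.nonWandering, G.SumDiverges F β v) :
    m (G.recurrentPaths)ᶜ = 0 := by
  have key (a : {a // G.src a ∈ G.nonWandering}) (μ : G.FinPath) :
      m (G.cylinder μ \ ⋃ n, G.passage {a.1}ᶜ {a.1} μ.arrows.length n) = 0 := by
    have h1 := hm.measure_iUnion_passage {a.1} μ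
    have h2 := congrFun (hm.tsum_passageMass_eq hsimple hφ a.2 (hdiv _ a.2)) μ.range
    rw [h2, pathWeight, ← hm μ] at h1
    have hfin : m (G.cylinder μ) ≠ ∞ := by
      rw [hm μ]
      exact ENNReal.mul_ne_top ENNReal.ofReal_ne_top ENNReal.coe_ne_top
    rw [← Set.sdiff_self_inter, measure_sdiff Set.inter_subset_left, h1, tsub_self]
    · exact ((measurableSet_cylinder _).inter
        (MeasurableSet.iUnion fun n => measurableSet_passage _ _ _ _)).nullMeasurableSet
    · rw [h1]
      exact hfin
  refine measure_mono_null ?_ (measure_iUnion_null fun a => measure_iUnion_null fun μ => key a μ)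
  intro p hp
  have h1 : ∃ a, G.src a ∈ G.nonWandering ∧ ¬ {i : ℕ | p.1 i = a}.Infinite := by
    by_contra! hcon
    exact hp ⟨hne, hcon⟩
  obtain ⟨a, ha, hinf⟩ := h1
  obtain ⟨N, hN⟩ := (Set.not_infinite.1 hinf).bddAbove
  obtain ⟨μ, hμ, hpμ⟩ := exists_mem_cylinder p (N + 1)
  simp only [Set.mem_iUnion]
  refine ⟨⟨a, ha⟩, μ, hpμ, ?_⟩
  simp only [Set.mem_iUnion, not_exists]
  intro n hn
  have h2 : μ.arrows.length + n ≤ N := hN hn.2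
  omega

end Recurrence

end DiGraph

/-! ### Trajectories in a discrete space -/

section Trajectories

open MeasureTheory ProbabilityTheory ProbabilityTheory.Kernel Finset Preorder

variable {α : Type*} [MeasurableSpace α] [DiscreteMeasurableSpace α] [Countable α]
  {κ : (n : ℕ) → Kernel (Iic n → α) α} [∀ n, IsMarkovKernel (κ n)]

theorem traj_compl_start (n : ℕ) (z : Iic n → α) :
    traj (X := fun _ => α) κ n z (frestrictLe (π := fun _ => α) n ⁻¹' {z}ᶜ) = 0 := by
  have h1 := congrArg (fun η => η z) (traj_map_frestrictLe_of_le (X := fun _ => α) (κ := κ)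
    (le_refl n))
  rw [Kernel.map_apply _ (measurable_frestrictLe n), Kernel.deterministic_apply] at h1
  have h2 := congrArg (fun ν => ν {z}ᶜ) h1
  beta_reduce at h2
  rw [Measure.map_apply (measurable_frestrictLe n) (.of_discrete), Measure.dirac_apply' _
    (.of_discrete)] at h2
  rw [h2, Set.indicator_of_notMem]
  simp only [Set.mem_compl_iff, Set.mem_singleton_iff, not_not]
  rfl

theorem traj_inter_succ (n : ℕ) (z : Iic n → α) (D : Set (Iic n → α)) (R : Set α) (c : ℝ≥0∞)
    (hD : ∀ y ∈ D, κ n y R = c) :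
    traj (X := fun _ => α) κ n z (frestrictLe (π := fun _ => α) n ⁻¹' D ∩ {p | p (n + 1) ∈ R}) =
      D.indicator (fun _ => c) z := by
  by_cases hz : z ∈ D
  · rw [Set.indicator_of_mem hz, ← hD z hz]
    have h1 := congrArg (fun η => η z R) (map_traj_succ_self (X := fun _ => α) (κ := κ) (a := n))
    rw [Kernel.map_apply' _ (measurable_pi_apply _) _ (.of_discrete)] at h1
    rw [← h1]
    apply measure_congr
    have h2 := traj_compl_start (κ := κ) n z
    rw [Set.preimage_compl] at h2
    filter_upwards [mem_ae_iff.2 h2] with p hp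
    refine propext ⟨fun h => h.2, fun h => ⟨?_, h⟩⟩
    change frestrictLe n p ∈ D
    rw [show frestrictLe n p = z from hp]
    exact hz
  · rw [Set.indicator_of_notMem hz]
    refine measure_mono_null ?_ (traj_compl_start (κ := κ) n z)
    rintro p ⟨h1, -⟩ h2
    exact hz (h2 ▸ h1)

/-- Markov property: disintegrating at time `n`, the next arrow lies in `R` with the same
probability `c` for every history in `D`. -/
theorem traj_zero_inter_succ (x : Iic 0 → α) (n : ℕ) (D : Set (Iic n → α)) (R : Set α)
    (c : ℝ≥0∞) (hD : ∀ y ∈ D, κ n y R = c) :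
    traj (X := fun _ => α) κ 0 x (frestrictLe (π := fun _ => α) n ⁻¹' D ∩ {p | p (n + 1) ∈ R}) =
      traj (X := fun _ => α) κ 0 x (frestrictLe (π := fun _ => α) n ⁻¹' D) * c := by
  have hm : MeasurableSet (frestrictLe (π := fun _ => α) n ⁻¹' D ∩ {p | p (n + 1) ∈ R}) :=
    ((measurable_frestrictLe n) (.of_discrete)).inter
      (measurable_pi_apply (n + 1) (.of_discrete (s := R)))
  conv_lhs => rw [← traj_comp_partialTraj (X := fun _ => α) (Nat.zero_le n)]
  rw [Kernel.comp_apply' _ _ _ hm]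
  simp_rw [traj_inter_succ n _ D R c hD]
  rw [lintegral_indicator_const (.of_discrete), ← traj_map_frestrictLe_apply,
    Measure.map_apply (measurable_frestrictLe n) (.of_discrete), mul_comm]

end Trajectories

namespace DiGraph

/-! ### Existence of the path measure -/

section PathMeasure

open MeasureTheory ProbabilityTheory Preorder

variable {V Ar : Type*} {G : DiGraph V Ar} {F : Ar → ℝ} {β : ℝ}
  {φ : V → ℝ≥0}

open Classical in
-- Harmonicity at `v` is exactly the normalisation of the Doob transform by `φ`.
theorem IsHarmonic.tsum_step (hφ : G.IsHarmonic F β φ) (hpos : ∀ v, φ v ≠ 0) (v : V) :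
    ∑' a, (if G.src a = v then arrowWeight F β a * φ (G.rng a) / φ v else 0) = 1 := by
  have h1 : ∑' a : {a // G.src a = v}, arrowWeight F β a * (φ (G.rng a) : ℝ≥0∞) = φ v :=
    (G.transfer_eq_tsum_out F β (fun v => φ v) v).symm.trans (hφ.eq v)
  have h2 : (φ v : ℝ≥0∞) ≠ 0 := by simpa using hpos v
  rw [← ENNReal.mul_inv_cancel h2 ENNReal.coe_ne_top]
  nth_rw 2 [← h1]
  simp only [div_eq_mul_inv]
  rw [← ENNReal.tsum_mul_right]
  refine Eq.trans ?_ (tsum_subtype {a | G.src a = v} (fun a =>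
    arrowWeight F β a * (φ (G.rng a) : ℝ≥0∞) * (φ v : ℝ≥0∞)⁻¹)).symm
  exact tsum_congr fun a => by rw [Set.indicator_apply]; rfl

open Classical in
/-- The transition probabilities of the Markov chain of a positive harmonic vector. -/
noncomputable def IsHarmonic.step (hφ : G.IsHarmonic F β φ) (hpos : ∀ v, φ v ≠ 0) (v : V) :
    PMF Ar :=
  ⟨fun a => if G.src a = v then arrowWeight F β a * φ (G.rng a) / φ v else 0,
    hφ.tsum_step hpos v ▸ ENNReal.summable.hasSum⟩

theorem rng_last_eq_range (μ : G.FinPath) {n : ℕ} (hn : μ.arrows.length = n + 1) :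
    G.rng (μ.arrows[n]) = μ.range := by
  obtain ⟨μ', a, ha, rfl⟩ := μ.exists_eq_snoc (by rintro h; simp [h] at hn)
  rw [FinPath.length_snoc] at hn
  obtain rfl : μ'.arrows.length = n := by omega
  exact congrArg G.rng (List.getElem_concat_length rfl _)

theorem src_first_eq_source (μ : G.FinPath) (hn : 0 < μ.arrows.length) :
    G.src (μ.arrows[0]) = μ.source := by
  obtain ⟨v, l, w, hp⟩ := μ
  cases l with
  | nil => simp at hn
  | cons a l => exact hp.1

variable [Countable Ar]

/-- A positive harmonic vector defines a measure on the space of all sequences of arrows. -/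
theorem IsHarmonic.exists_measure_sequences [Countable V] [MeasurableSpace Ar]
    [DiscreteMeasurableSpace Ar] (hφ : G.IsHarmonic F β φ) (hpos : ∀ v, φ v ≠ 0) :
    ∃ m : Measure (ℕ → Ar), m {p | ∃ i, G.rng (p i) ≠ G.src (p (i + 1))} = 0 ∧
      ∀ μ : G.FinPath, 0 < μ.arrows.length →
        m {p | ∀ (i : ℕ) (hi : i < μ.arrows.length), p i = μ.arrows[i]} =
          G.pathWeight F β μ * φ μ.range := by
  classical
  let κ (n : ℕ) : Kernel (Finset.Iic n → Ar) Ar :=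
    ⟨fun y => (hφ.step hpos (G.rng (y ⟨n, Finset.mem_Iic.2 le_rfl⟩))).toMeasure, .of_discrete⟩
  have : ∀ n, IsMarkovKernel (κ n) := fun n => ⟨fun y => PMF.toMeasure.isProbabilityMeasure _⟩
  have hκ (n : ℕ) (y : Finset.Iic n → Ar) (b : Ar) : κ n y {b} =
      if G.src b = G.rng (y ⟨n, Finset.mem_Iic.2 le_rfl⟩) then arrowWeight F β b * φ (G.rng b) /
        φ (G.rng (y ⟨n, Finset.mem_Iic.2 le_rfl⟩)) else 0 :=
    PMF.toMeasure_apply_singleton _ _ (.of_discrete)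
  -- The weight of the starting arrow `a` is the prescribed mass of its cylinder, so the total mass
  -- may be infinite.
  let m : Measure (ℕ → Ar) := Measure.sum fun a : Ar =>
    (arrowWeight F β a * (φ (G.rng a) : ℝ≥0∞)) • Kernel.traj (X := fun _ => Ar) κ 0 (fun _ => a)
  have hm {C : Set (ℕ → Ar)} (hC : MeasurableSet C) : m C = ∑' a : Ar,
      arrowWeight F β a * (φ (G.rng a) : ℝ≥0∞) *
        Kernel.traj (X := fun _ => Ar) κ 0 (fun _ => a) C :=
    Measure.sum_apply _ hC
  have hmeas (n : ℕ) (D : Set (Finset.Iic n → Ar)) :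
      MeasurableSet (frestrictLe (π := fun _ => Ar) n ⁻¹' D) :=
    (measurable_frestrictLe n) (.of_discrete)
  have hstep (n : ℕ) (D : Set (Finset.Iic n → Ar)) (R : Set Ar) (c : ℝ≥0∞)
      (hD : ∀ y ∈ D, κ n y R = c) :
      m (frestrictLe (π := fun _ => Ar) n ⁻¹' D ∩ {p | p (n + 1) ∈ R}) =
        m (frestrictLe (π := fun _ => Ar) n ⁻¹' D) * c := by
    have hR : MeasurableSet {p : ℕ → Ar | p (n + 1) ∈ R} :=
      (measurable_pi_apply (n + 1)) (.of_discrete (s := R))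
    rw [hm (hmeas n D), hm ((hmeas n D).inter hR), ← ENNReal.tsum_mul_right]
    refine tsum_congr fun a => ?_
    rw [traj_zero_inter_succ _ n D R c hD, mul_assoc _ _ c]
  refine ⟨m, ?_, ?_⟩
  · have h1 : {p : ℕ → Ar | ∃ i, G.rng (p i) ≠ G.src (p (i + 1))} = ⋃ (i : ℕ) (v : V),
        frestrictLe (π := fun _ => Ar) i ⁻¹' {y | G.rng (y ⟨i, Finset.mem_Iic.2 le_rfl⟩) = v} ∩
          {p | p (i + 1) ∈ {b | G.src b ≠ v}} := by
      ext p
      simp only [Set.mem_iUnion]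
      constructor
      · rintro ⟨i, hi⟩
        exact ⟨i, _, rfl, hi.symm⟩
      · rintro ⟨i, v, hv, h⟩
        exact ⟨i, fun h' => h (h'.symm.trans hv)⟩
    rw [h1]
    refine measure_iUnion_null fun i => measure_iUnion_null fun v => ?_
    rw [hstep i _ _ 0, mul_zero]
    intro y hy
    rw [← Set.biUnion_of_singleton {b | G.src b ≠ v}, measure_biUnion_null_iff (Set.to_countable _)]
    intro b hb
    rw [hκ, if_neg]
    rw [show G.rng (y _) = v from hy]
    exact hb
  · intro μ hμ
    obtain ⟨n, hn⟩ := Nat.exists_eq_add_one_of_ne_zero hμ.ne'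
    clear hμ
    have hC (n : ℕ) (μ : G.FinPath) (hn : μ.arrows.length = n + 1) :
        {p : ℕ → Ar | ∀ (i : ℕ) (hi : i < μ.arrows.length), p i = μ.arrows[i]} =
          frestrictLe (π := fun _ => Ar) n ⁻¹' {y | ∀ (i : ℕ) (hi : i < μ.arrows.length),
            y ⟨i, Finset.mem_Iic.2 (by omega)⟩ = μ.arrows[i]} := rfl
    induction n generalizing μ with
    | zero =>
      obtain ⟨b, hb⟩ : ∃ b, μ.arrows = [b] := List.length_eq_one_iff.1 hn
      have h1 : {p : ℕ → Ar | ∀ (i : ℕ) (hi : i < μ.arrows.length), p i = μ.arrows[i]} =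
          {p | p 0 = b} := by
        ext p
        constructor
        · intro h
          have := h 0 (by simp [hb])
          simpa [hb] using this
        · rintro (h : p 0 = b) i hi
          obtain rfl : i = 0 := by omega
          simpa [hb] using h
      have h2 : MeasurableSet {p : ℕ → Ar | p 0 = b} :=
        measurableSet_eq_fun (measurable_pi_apply 0) measurable_const
      have h3 : G.rng b = μ.range := by
        have := rng_last_eq_range μ hn
        simpa [hb] using this
      have h4 : G.pathWeight F β μ = arrowWeight F β b := by
        simp [pathWeight, arrowWeight, hb]
      have h5 (a : Ar) : Kernel.traj (X := fun _ => Ar) κ 0 (fun _ => a) {p | p 0 = a}ᶜ = 0 := by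
        refine measure_mono_null ?_ (traj_compl_start (κ := κ) 0 (fun _ => a))
        intro p hp h'
        exact hp (congrFun h' ⟨0, Finset.mem_Iic.2 le_rfl⟩)
      rw [h1, hm h2, tsum_eq_single b, h4, ← h3, (prob_compl_eq_zero_iff h2).1 (h5 b), mul_one]
      intro a ha
      rw [measure_mono_null ?_ (h5 a), mul_zero]
      rintro p (hp : p 0 = b) (hp' : p 0 = a)
      exact ha (hp'.symm.trans hp)
    | succ n ih =>
      obtain ⟨μ', b, hb, rfl⟩ := μ.exists_eq_snoc (by rintro h; simp [h] at hn)
      rw [FinPath.length_snoc] at hn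
      have hn' : μ'.arrows.length = n + 1 := by omega
      have h1 : {p : ℕ → Ar | ∀ (i : ℕ) (hi : i < (μ'.snoc b hb).arrows.length),
          p i = (μ'.snoc b hb).arrows[i]} =
          {p : ℕ → Ar | ∀ (i : ℕ) (hi : i < μ'.arrows.length), p i = μ'.arrows[i]} ∩
            {p | p (n + 1) ∈ ({b} : Set Ar)} := by
        ext p
        constructor
        · intro h
          refine ⟨fun i hi => ?_, ?_⟩
          · rw [h i (by rw [FinPath.length_snoc]; omega)]
            exact List.getElem_append_left hi
          · refine (h (n + 1) (by rw [FinPath.length_snoc]; omega)).trans ?_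
            exact List.getElem_concat_length hn'.symm _
        · rintro ⟨h2, h3⟩ i hi
          rw [FinPath.length_snoc] at hi
          rcases Nat.lt_succ_iff_lt_or_eq.1 hi with hi' | rfl
          · rw [h2 i hi']
            exact (List.getElem_append_left hi').symm
          · refine Eq.trans (?_ : _ = b) (List.getElem_concat_length rfl _).symm
            rw [hn']
            exact h3
      have h0 : (φ μ'.range : ℝ≥0∞) ≠ 0 := by simpa using hpos μ'.range
      -- The transition probability divides by `φ` at the end of `μ'`, cancelling the factor from
      -- the induction hypothesis.
      rw [h1, hC n μ' hn', hstep n _ {b} (arrowWeight F β b * φ (G.rng b) / φ μ'.range),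
        ← hC n μ' hn', ih μ' hn' hC, pathWeight_snoc]
      · change _ = _ * (φ (G.rng b) : ℝ≥0∞)
        rw [mul_assoc, ENNReal.mul_div_cancel h0 ENNReal.coe_ne_top, mul_assoc]
      · intro y hy
        have h2 : G.rng (y ⟨n, Finset.mem_Iic.2 le_rfl⟩) = μ'.range := by
          rw [hy n (by omega)]
          exact rng_last_eq_range μ' hn'
        rw [hκ, h2, if_pos hb]

/-- The sequences that are not paths form a null set, so the measure on sequences restricts along
the embedding of the path space. -/
theorem IsHarmonic.exists_isPathMeasure [Countable V] (hφ : G.IsHarmonic F β φ)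
    (hpos : ∀ v, φ v ≠ 0) : ∃ m, G.IsPathMeasure F β φ m := by
  let : MeasurableSpace Ar := ⊤
  let : TopologicalSpace Ar := ⊥
  have : DiscreteTopology Ar := ⟨rfl⟩
  have : BorelSpace Ar := ⟨(borel_eq_top_of_discrete).symm⟩
  obtain ⟨m₀, hnull, hm₀⟩ := hφ.exists_measure_sequences hpos
  let ι : G.InfPath → ℕ → Ar := fun p => p.1
  have hι : Function.Injective ι := Subtype.val_injective
  have hrange : Set.range ι = {p | ∃ i, G.rng (p i) ≠ G.src (p (i + 1))}ᶜ := by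
    ext p
    simp only [Set.mem_range, Set.mem_compl_iff]
    constructor
    · rintro ⟨q, rfl⟩ ⟨i, hi⟩
      exact hi (q.2 i)
    · intro h
      exact ⟨⟨p, fun i => by
        by_contra hi
        exact h ⟨i, hi⟩⟩, rfl⟩
  have hcomap : (inferInstance : MeasurableSpace G.InfPath) =
      MeasurableSpace.comap ι MeasurableSpace.pi := by
    rw [BorelSpace.measurable_eq (α := ℕ → Ar), ← borel_comap]
    rfl
  have hmrange : MeasurableSet (Set.range ι) := by
    rw [hrange]
    refine MeasurableSet.compl ?_
    have h1 : {p : ℕ → Ar | ∃ i, G.rng (p i) ≠ G.src (p (i + 1))} =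
        ⋃ i, (fun p : ℕ → Ar => (p i, p (i + 1))) ⁻¹' {q | G.rng q.1 ≠ G.src q.2} := by
      ext p
      simp
    rw [h1]
    exact MeasurableSet.iUnion fun i => ((measurable_pi_apply i).prodMk
      (measurable_pi_apply (i + 1))) (.of_discrete)
  have hemb : MeasurableEmbedding ι :=
    MeasurableEmbedding.iff_comap_eq.2 ⟨hι, hcomap.symm, hmrange⟩
  refine ⟨m₀.comap ι, ?_⟩
  have key (μ : G.FinPath) (hμ : 0 < μ.arrows.length) :
      m₀.comap ι (G.cylinder μ) = G.pathWeight F β μ * φ μ.range := by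
    rw [hemb.comap_apply, ← hm₀ μ hμ]
    apply measure_congr
    have hae : m₀ (Set.range ι)ᶜ = 0 := by rwa [hrange, compl_compl]
    filter_upwards [mem_ae_iff.2 hae] with p hp
    obtain ⟨q, rfl⟩ := hp
    refine propext ⟨?_, fun h => ⟨q, ⟨?_, h⟩, rfl⟩⟩
    · rintro ⟨q', hq', h⟩
      obtain rfl := hι h
      exact hq'.2
    · rw [← src_first_eq_source μ hμ, ← h 0 hμ]
  intro μ
  -- The measure on sequences is prescribed on cylinders of positive length only; for a vertex, sum
  -- over the first arrow and use harmonicity.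
  rcases Nat.eq_zero_or_pos μ.arrows.length with h0 | hpos'
  · have h1 := measure_cylinder_inter (m₀.comap ι) μ MeasurableSet.univ
    simp only [Set.inter_univ] at h1
    rw [h1, ← pathWeight]
    have h2 : ∑' a : {a // G.src a = μ.range}, arrowWeight F β a * (φ (G.rng a) : ℝ≥0∞) =
        φ μ.range :=
      (G.transfer_eq_tsum_out F β (fun v => φ v) μ.range).symm.trans (hφ.eq μ.range)
    rw [← h2, ← ENNReal.tsum_mul_left]
    refine tsum_congr fun a => ?_
    rw [key _ (by simp [FinPath.snoc]), pathWeight_snoc, mul_assoc]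
    rfl
  · exact key μ hpos'

end PathMeasure

end DiGraph

theorem theorem2p7 {V Ar : Type*} [Countable V] [Countable Ar] (G : DiGraph V Ar)
    (hsimple : DiGraph.IsSimpleCStar G.GraphCStar) (F : Ar → ℝ) (β : ℝ) :
    -- a conservative harmonic vector exists iff the three conditions hold for one vertex
    ((∃ φ : V → ℝ≥0, G.IsConservative F β φ) ↔
      G.nonWandering.Nonempty ∧
        ∃ v ∈ G.nonWandering, G.SumDiverges F β v ∧ G.LimsupEqOne F β v) ∧
    -- and iff they hold for all vertices
    ((∃ φ : V → ℝ≥0, G.IsConservative F β φ) ↔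
      G.nonWandering.Nonempty ∧
        ∀ v ∈ G.nonWandering, G.SumDiverges F β v ∧ G.LimsupEqOne F β v) ∧
    -- each of the conditions does not depend on the choice of the vertex
    (∀ v ∈ G.nonWandering, ∀ w ∈ G.nonWandering,
      (G.SumDiverges F β v ↔ G.SumDiverges F β w) ∧
      (G.LimsupEqOne F β v ↔ G.LimsupEqOne F β w)) ∧
    -- uniqueness up to scalars
    (∀ φ φ' : V → ℝ≥0, G.IsConservative F β φ → G.IsConservative F β φ' →
      ∃ c : ℝ≥0, 0 < c ∧ φ' = c • φ) ∧
    -- minimality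
    (∀ φ : V → ℝ≥0, G.IsConservative F β φ → G.IsMinimal F β φ) := by
  have hreach {v : V} (hv : v ∈ G.nonWandering) (w : V) :=
    DiGraph.reflTransGen_of_mem_nonWandering hsimple hv w
  have hsum {v w : V} (hv : v ∈ G.nonWandering) (hw : w ∈ G.nonWandering)
      (h : G.SumDiverges F β v) : G.SumDiverges F β w :=
    h.of_communicating (hreach hv w) (hreach hw v)
  have hlim {v w : V} (hv : v ∈ G.nonWandering) (hw : w ∈ G.nonWandering)
      (h : G.LimsupEqOne F β v) : G.LimsupEqOne F β w :=
    ((DiGraph.limsup_powA_le_of_communicating (hreach hw v) (hreach hv w)).antisymm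
      (DiGraph.limsup_powA_le_of_communicating (hreach hv w) (hreach hw v))).trans h
  have hex {v : V} (hv : v ∈ G.nonWandering) (h : G.SumDiverges F β v)
      (h' : G.LimsupEqOne F β v) : ∃ φ : V → ℝ≥0, G.IsConservative F β φ := by
    obtain ⟨φ, hφ⟩ := h.exists_isHarmonic hsimple hv h'
    obtain ⟨m, hm⟩ := hφ.exists_isPathMeasure
      (hφ.isAlmostHarmonic.apply_ne_zero hsimple ⟨v, hv⟩)
    exact ⟨φ, hφ, m, hm, hm.measure_compl_recurrentPaths hsimple hφ ⟨v, hv⟩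
      fun w hw => hsum hv hw h⟩
  have hcond {φ : V → ℝ≥0} (h : G.IsConservative F β φ) (v : V) (hv : v ∈ G.nonWandering) :
      G.SumDiverges F β v ∧ G.LimsupEqOne F β v :=
    ⟨h.sumDiverges hsimple hv, h.limsupEqOne hsimple hv⟩
  refine ⟨⟨?_, ?_⟩, ⟨?_, ?_⟩, ?_, ?_, ?_⟩
  · rintro ⟨φ, h⟩
    obtain ⟨v, hv⟩ := h.nonWandering_nonempty
    exact ⟨⟨v, hv⟩, v, hv, hcond h v hv⟩
  · rintro ⟨-, v, hv, h, h'⟩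
    exact hex hv h h'
  · rintro ⟨φ, h⟩
    exact ⟨h.nonWandering_nonempty, hcond h⟩
  · rintro ⟨⟨v, hv⟩, h⟩
    exact hex hv (h v hv).1 (h v hv).2
  · exact fun v hv w hw => ⟨⟨hsum hv hw, hsum hw hv⟩, ⟨hlim hv hw, hlim hw hv⟩⟩
  · intro φ φ' h h'
    obtain ⟨v, hv⟩ := h.nonWandering_nonempty
    exact (h.sumDiverges hsimple hv).exists_eq_smul hsimple hv h.harmonic.isAlmostHarmonic
      h'.harmonic.isAlmostHarmonic
  · intro φ h
    obtain ⟨v, hv⟩ := h.nonWandering_nonempty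
    -- Minimality is uniqueness up to scalars among all almost harmonic vectors.
    exact ⟨h.harmonic.isAlmostHarmonic, fun φ' h' _ =>
      (h.sumDiverges hsimple hv).exists_eq_smul hsimple hv h.harmonic.isAlmostHarmonic h'⟩
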